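/- Let $\Lambda$ be a complete Noetherian local ring with residue field $k$, and let $\operatorname{Art}(\Lambda,k)$ be the category of local Artin $\Lambda$-algebras with residue field $k$; write $\pi:A\to k$ for the residue map, and, for a finite-dimensional $k$-vector space $V$, let $k[V]=k\oplus V$ be the trivial square-zero extension, a $\Lambda$-algebra through $\Lambda\to k$. A small extension with kernel $I$ is a surjection $f:A'\to A$ in $\operatorname{Art}(\Lambda,k)$ with $I=\ker f$ and $I\cdot\mathfrak m_{A'}=0$; then $I$ is a finite-dimensional $k$-vector space. Let $\mathcal S$ be a deformation stack, that is, a category fibered in groupoids over $\operatorname{Art}(\Lambda,k)^{\rm opp}$ such that $\mathcal S_k$ is non-empty with a unique morphism between any two objects, and such that for all $p':A'\to A$ and all surjective $p'':A''\to A$: (i) for objects $\eta,\eta'$ over $B=A'\times_AA''$ the map $\operatorname{Mor}(\eta,\eta')\to\operatorname{Mor}(\eta|_{A'},\eta'|_{A'})\times_{\operatorname{Mor}(\eta|_A,\eta'|_A)}\operatorname{Mor}(\eta|_{A''},\eta'|_{A''})$ is bijective (morphisms in the fiber categories); (ii) for $\eta'$ over $A'$, $\eta''$ over $A''$ and $\varphi:\eta'|_A\to\eta''|_A$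 in $\mathcal S_A$ there is an object over $B$ with restrictions $\eta'$ and $\eta''$ inducing $\varphi$. Morphisms of $\mathcal S$ go from a pushforward $\eta|_{A}$ to the object $\eta$ over $A'$ when $A'\to A$ is the ring map. Fix an object $\zeta_0$ over $k$ and pushforwards $\zeta_V$ of $\zeta_0$ under $k\to k[V]$. Notation. $T_V$ is the set of isomorphism classes of $\mathcal S_{k[V]}$, and $A_V=\operatorname{Aut}(\zeta_V)$. For a small extension $A'\to A$ with kernel $I$ and $\eta\in\mathcal S_A$, $T_{\eta,A'}$ is the set of isomorphism classes of pairs $(\eta',\varphi)$ with $\eta'\in\mathcal S_{A'}$ and $\varphi:\eta\to\eta'$ over $A'\to A$. For $\eta'\in\mathcal S_{A'}$ and $\varphi\in\operatorname{Aut}(\eta'|_A)$, $A_{\varphi,\eta'}=\{\varphi'\in\operatorname{Aut}(\eta'):\varphi'|_A=\varphi\}$. The addition law $+_{A',I}:\mathcal S_{A'}\times\mathcal S_{k[I]}\to\mathcal S_{A'}$ is the functor $(\eta_1,\eta_2)\mapsto\sigma_*(\eta_1*\eta_2)$, where $\eta_1*\eta_2$ is an object over $A'\times_kk[I]$ with restrictions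 $\eta_1$ and $\eta_2$, and $\sigma:A'\times_kk[I]\to A'$ is $(x,\pi(x)+i)\mapsto x+i$; it acts on morphisms accordingly, and $\eta'+\zeta_I$ is canonically identified with $\eta'$. The case $A'=k[I]$, $A=k$ gives $+_{k[I],I}$. A set with an action of a group is a pseudotorsor if it is empty or a torsor. Theorem. The addition laws $+_{A',I}$ exist, and the following holds for every choice of them. (1) $+_{k[I],I}$ gives canonical abelian group structures on $T_I$ and $A_I$, and the addition on $A_I$ agrees with composition. These are functorial: pushforward along $k[I]\to k[J]$, for a $k$-linear map $I\to J$ of finite-dimensional vector spaces, gives group homomorphisms $T_I\to T_J$ and $A_I\to A_J$, compatibly with identities and composition. (2) For a small extension $A'\to A$ with kernel $I$ and $\eta\in\mathcal S_A$, $+_{A',I}$ induces a canonical action of $T_I$ on $T_{\eta,A'}$, which makes $T_{\eta,A'}$ a pseudotorsor under $T_I$. (3) For $\eta'\in\mathcal S_{A'}$, $+_{A',I}$ induces a canonical group isomorphism $A_I\cong A_{\operatorname{id},\eta'}$, $\psi\mapsto\operatorname{id}_{\eta'}+\psi$. For any $\varphi\in\operatorname{Aut}(\eta'|_A)$ it induces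 a canonical action of $A_I$ on $A_{\varphi,\eta'}$, given by $\varphi'\mapsto\varphi'+\psi$, or equivalently by composition with $\operatorname{id}_{\eta'}+\psi$, which makes $A_{\varphi,\eta'}$ a pseudotorsor under $A_I$. (4) Both pseudotorsor structures are functorial: if $B'\to B$ is another small extension, with kernel $J$, and $A'\to B'$ is a homomorphism in $\operatorname{Art}(\Lambda,k)$ which induces $I\to J$ and $A\to B$, then the restriction maps $T_{\eta,A'}\to T_{\eta|_B,B'}$ and $A_{\varphi,\eta'}\to A_{\varphi|_B,\eta'|_{B'}}$ are defined and commute with the actions, via $T_I\to T_J$ and $A_I\to A_J$ respectively. -/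

import Mathlib

open CategoryTheory Opposite

universe u v₂ u₂

set_option linter.unusedSectionVars false

/-- `Λ` is a complete Noetherian local ring with residue field `k` (the residue map being the
structure map `Λ → k`). -/
class CompleteLocalBase (Λ k : Type u) [CommRing Λ] [Field k] [Algebra Λ k] : Prop
    extends IsLocalRing Λ, IsNoetherianRing Λ where
  complete : IsAdicComplete (IsLocalRing.maximalIdeal Λ) Λ
  surj : Function.Surjective (algebraMap Λ k)

/-- A local Artin `Λ`-algebra with residue field `k`. Since `Λ → k` is onto, the residue map
`π`, a map of `Λ`-algebras, is onto, and it is determined by the `Λ`-algebra `carrier`. -/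
structure ArtAlg (Λ k : Type u) [CommRing Λ] [Field k] [Algebra Λ k] where
  carrier : Type u
  [commRing : CommRing carrier]
  [algebra : Algebra Λ carrier]
  [isLocalRing : IsLocalRing carrier]
  [isArtinianRing : IsArtinianRing carrier]
  /-- the residue field map -/
  π : carrier →ₐ[Λ] k

namespace ArtAlg

attribute [instance] commRing algebra isLocalRing isArtinianRing

section basics

variable {Λ k : Type u} [CommRing Λ] [Field k] [Algebra Λ k]

instance : CoeSort (ArtAlg Λ k) (Type u) := ⟨carrier⟩

/-- The category `Art(Λ, k)`: all homomorphisms of `Λ`-algebras (they are automatically local and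
compatible with the residue maps, see `π_comp`). -/
instance : Category (ArtAlg Λ k) where
  Hom A B := A →ₐ[Λ] B
  id A := AlgHom.id Λ A
  comp f g := g.comp f

/-- A ring map `A' → A`, seen as an arrow from `A` to `A'` of the opposite category. -/
def arrow {A' A : ArtAlg Λ k} (f : A' →ₐ[Λ] A) : op A ⟶ op A' :=
  Quiver.Hom.op (V := ArtAlg Λ k) f

theorem π_eq_zero_of_isNilpotent {A : ArtAlg Λ k} {x : A} (h : IsNilpotent x) : A.π x = 0 :=
  (h.map A.π).eq_zero

variable [CompleteLocalBase Λ k]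

theorem π_surjective (A : ArtAlg Λ k) : Function.Surjective A.π := fun c => by
  obtain ⟨l, rfl⟩ := CompleteLocalBase.surj (Λ := Λ) c
  exact ⟨algebraMap Λ A l, A.π.commutes l⟩

theorem π_eq_zero_iff {A : ArtAlg Λ k} {x : A} :
    A.π x = 0 ↔ x ∈ IsLocalRing.maximalIdeal A := by
  have h := IsLocalRing.eq_maximalIdeal
    (RingHom.ker_isMaximal_of_surjective A.π.toRingHom A.π_surjective)
  rw [← h]; rfl

theorem isNilpotent_of_π {A : ArtAlg Λ k} {x : A} (h : A.π x = 0) : IsNilpotent x := by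
  rw [π_eq_zero_iff] at h
  obtain ⟨n, hn⟩ := IsArtinianRing.isNilpotent_jacobson_bot (R := A)
  refine ⟨n, ?_⟩
  rw [IsLocalRing.jacobson_eq_maximalIdeal ⊥ bot_ne_top] at hn
  have := Ideal.pow_mem_pow h n
  rw [hn] at this
  simpa using this

theorem exists_sub (A : ArtAlg Λ k) (x : A) : ∃ l : Λ, A.π (x - algebraMap Λ A l) = 0 := by
  obtain ⟨l, hl⟩ := CompleteLocalBase.surj (Λ := Λ) (A.π x)
  exact ⟨l, by rw [map_sub, AlgHom.commutes, hl, sub_self]⟩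

theorem π_comp {A B : ArtAlg Λ k} (f : A →ₐ[Λ] B) (x : A) : B.π (f x) = A.π x := by
  obtain ⟨l, hl⟩ := A.exists_sub x
  have h1 := π_eq_zero_of_isNilpotent ((isNilpotent_of_π hl).map f)
  rw [map_sub, map_sub, AlgHom.commutes, AlgHom.commutes] at h1
  rw [map_sub, AlgHom.commutes] at hl
  rw [sub_eq_zero.1 h1, sub_eq_zero.1 hl]

theorem isUnit_of_π {A : ArtAlg Λ k} {x : A} (h : A.π x ≠ 0) : IsUnit x := by
  rw [Ne, π_eq_zero_iff, IsLocalRing.mem_maximalIdeal, mem_nonunits_iff, not_not] at h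
  exact h

theorem isArtinian_aux (A : ArtAlg Λ k) (M : Type u) [AddCommGroup M] [Module A M] [Module Λ M]
    [IsScalarTower Λ A M] [IsArtinian A M]
    (hM : ∀ a ∈ IsLocalRing.maximalIdeal A, ∀ m : M, a • m = 0) : IsArtinian Λ M := by
  let F : Submodule Λ M → Submodule A M := fun N =>
    { N with
      smul_mem' := by
        intro a m hm
        obtain ⟨l, hl⟩ := A.exists_sub a
        have h := hM _ (π_eq_zero_iff.1 hl) m
        rw [sub_smul, sub_eq_zero, algebraMap_smul] at h
        rw [h]
        exact N.smul_mem l hm }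
  refine ⟨Subrelation.wf (r := InvImage (· < ·) F) ?_ (InvImage.wf F wellFounded_lt)⟩
  intro a b h
  exact h

theorem isArtinian_base (A : ArtAlg Λ k) : IsArtinian Λ A := by
  have key : ∀ I : Ideal A, IsArtinian Λ I := by
    intro I
    induction I using (wellFounded_lt (α := Ideal A)).induction with
    | _ I ih =>
      by_cases hI : I = ⊥
      · subst hI
        infer_instance
      · have hfg : I.FG := IsNoetherian.noetherian I
        set J : Ideal A := IsLocalRing.maximalIdeal A • I with hJ
        have hlt : J < I := by
          refine lt_of_le_of_ne Submodule.smul_le_right fun h => hI ?_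
          exact Submodule.eq_bot_of_le_smul_of_le_jacobson_bot _ I hfg h.ge
            (IsLocalRing.maximalIdeal_le_jacobson ⊥)
        have := ih J hlt
        let N : Submodule A I := Submodule.comap (Submodule.subtype I) J
        have hN : IsArtinian Λ (I ⧸ N) := by
          refine isArtinian_aux A (I ⧸ N) fun a ha m => ?_
          obtain ⟨m, rfl⟩ := N.mkQ_surjective m
          rw [← map_smul, Submodule.mkQ_apply, Submodule.Quotient.mk_eq_zero]
          exact Submodule.smul_mem_smul ha m.2
        refine isArtinian_of_range_eq_ker
          ((Submodule.inclusion hlt.le).restrictScalars Λ) (N.mkQ.restrictScalars Λ) ?_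
        ext x
        simp only [LinearMap.mem_range, LinearMap.mem_ker, LinearMap.restrictScalars_apply,
          Submodule.mkQ_apply, Submodule.Quotient.mk_eq_zero]
        constructor
        · rintro ⟨y, rfl⟩
          exact y.2
        · intro h
          exact ⟨⟨x.1, h⟩, rfl⟩
  have := key ⊤
  exact isArtinian_of_linearEquiv
    ((Submodule.topEquiv (R := A) (M := A)).restrictScalars Λ)

/-- The residue field `k` as an object of `Art(Λ, k)`. -/
def base (Λ k : Type u) [CommRing Λ] [Field k] [Algebra Λ k] : ArtAlg Λ k where
  carrier := k
  π := AlgHom.id Λ k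

theorem isLocalRing_of_unit {R : Type u} [CommRing R] (φ : R →+* k)
    (h : ∀ x, φ x ≠ 0 → IsUnit x) : IsLocalRing R := by
  have : IsLocalHom φ := ⟨fun x hx => h x hx.ne_zero⟩
  exact RingHom.domain_isLocalRing φ

/-- The ring underlying `A' ×_A A''`. -/
abbrev fiberProdRing {A' A'' A : ArtAlg Λ k} (f : A' →ₐ[Λ] A) (g : A'' →ₐ[Λ] A) :
    Subalgebra Λ (A' × A'') :=
  AlgHom.equalizer (f.comp (AlgHom.fst Λ A' A'')) (g.comp (AlgHom.snd Λ A' A''))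

/-- The fiber product `A' ×_A A''` in `Art(Λ, k)`: pairs `(x, y)` with `f x = g y`. -/
def fiberProd {A' A'' A : ArtAlg Λ k} (f : A' →ₐ[Λ] A) (g : A'' →ₐ[Λ] A) : ArtAlg Λ k where
  carrier := fiberProdRing f g
  isLocalRing := by
    refine isLocalRing_of_unit (k := k)
      ((A'.π.comp (AlgHom.fst Λ A' A'')).comp (fiberProdRing f g).val).toRingHom ?_
    rintro ⟨⟨x, y⟩, hxy⟩ h
    have hxy' : f x = g y := hxy
    have hx : IsUnit x := isUnit_of_π h
    have hy : IsUnit y := by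
      refine isUnit_of_π ?_
      rw [← π_comp g y, ← hxy', π_comp]
      exact h
    obtain ⟨x', hx'⟩ := hx.exists_right_inv
    obtain ⟨y', hy'⟩ := hy.exists_right_inv
    refine IsUnit.of_mul_eq_one ⟨⟨x', y'⟩, ?_⟩ (Subtype.ext (Prod.ext hx' hy'))
    change f x' = g y'
    have h1 : f x * f x' = 1 := by rw [← map_mul, hx', map_one]
    have h2 : f x * g y' = 1 := by rw [hxy', ← map_mul, hy', map_one]
    calc f x' = (f x * g y') * f x' := by rw [h2, one_mul]
      _ = (f x * f x') * g y' := by ring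
      _ = g y' := by rw [h1, one_mul]
  isArtinianRing := by
    have := isArtinian_base A'
    have := isArtinian_base A''
    have : IsArtinian Λ (fiberProdRing f g) :=
      isArtinian_of_injective (fiberProdRing f g).val.toLinearMap Subtype.val_injective
    exact isArtinian_of_tower Λ this
  π := (A'.π.comp (AlgHom.fst Λ A' A'')).comp (fiberProdRing f g).val

section fiberProd

variable {A' A'' A : ArtAlg Λ k} (f : A' →ₐ[Λ] A) (g : A'' →ₐ[Λ] A)

/-- The first projection `A' ×_A A'' → A'`. -/
def fst : fiberProd f g →ₐ[Λ] A' := (AlgHom.fst Λ A' A'').comp (fiberProdRing f g).val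

/-- The second projection `A' ×_A A'' → A''`. -/
def snd : fiberProd f g →ₐ[Λ] A'' := (AlgHom.snd Λ A' A'').comp (fiberProdRing f g).val

/-- The map `C → A' ×_A A''` with components `a` and `b`. -/
def lift {C : ArtAlg Λ k} (a : C →ₐ[Λ] A') (b : C →ₐ[Λ] A'') (h : f.comp a = g.comp b) :
    C →ₐ[Λ] fiberProd f g :=
  (a.prod b).codRestrict (fiberProdRing f g) fun x => DFunLike.congr_fun h x

end fiberProd

end basics

section sqZero

variable (k : Type u) [Field k] (V : Type u) [AddCommGroup V] [Module k V]

/-- The underlying ring of `k[V]`: the trivial square-zero extension `k ⊕ V`. -/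
def SqZero : Type u := TrivSqZeroExt k V

noncomputable instance : CommRing (SqZero k V) :=
  letI : Module kᵐᵒᵖ V := Module.compHom V ((RingHom.id k).fromOpposite mul_comm)
  haveI : IsCentralScalar k V := ⟨fun _ _ => rfl⟩
  inferInstanceAs (CommRing (TrivSqZeroExt k V))

namespace SqZero

variable {k V}

/-- The element `c + v` of `k[V]`. -/
def mk (c : k) (v : V) : SqZero k V := (c, v)

/-- The coordinate in `k` of an element of `k[V]`. -/
def re (x : SqZero k V) : k := x.1

/-- The coordinate in `V` of an element of `k[V]`. -/
def im (x : SqZero k V) : V := x.2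

@[ext] theorem ext {x y : SqZero k V} (h₁ : x.re = y.re) (h₂ : x.im = y.im) : x = y :=
  Prod.ext h₁ h₂

@[simp] theorem re_mk (c : k) (v : V) : (mk c v).re = c := rfl
@[simp] theorem im_mk (c : k) (v : V) : (mk c v).im = v := rfl
@[simp] theorem re_add (x y : SqZero k V) : (x + y).re = x.re + y.re := rfl
@[simp] theorem im_add (x y : SqZero k V) : (x + y).im = x.im + y.im := rfl
@[simp] theorem re_mul (x y : SqZero k V) : (x * y).re = x.re * y.re := rfl
@[simp] theorem im_mul (x y : SqZero k V) : (x * y).im = x.re • y.im + y.re • x.im := rfl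
@[simp] theorem re_zero : (0 : SqZero k V).re = 0 := rfl
@[simp] theorem im_zero : (0 : SqZero k V).im = 0 := rfl
@[simp] theorem re_one : (1 : SqZero k V).re = 1 := rfl
@[simp] theorem im_one : (1 : SqZero k V).im = 0 := rfl

variable (k V) in
/-- The inclusion `k → k[V]`. -/
def inclHom : k →+* SqZero k V where
  toFun c := mk c 0
  map_one' := rfl
  map_mul' _ _ := by ext <;> simp
  map_zero' := rfl
  map_add' _ _ := by ext <;> simp

/-- The trivial `Λ`-algebra structure on `k[V]`, through `Λ → k`. -/
noncomputable instance {Λ : Type u} [CommRing Λ] [Algebra Λ k] : Algebra Λ (SqZero k V) :=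
  ((inclHom k V).comp (algebraMap Λ k)).toAlgebra

theorem algebraMap_eq {Λ : Type u} [CommRing Λ] [Algebra Λ k] (l : Λ) :
    algebraMap Λ (SqZero k V) l = mk (algebraMap Λ k l) 0 := rfl

end SqZero

variable (Λ : Type u) [CommRing Λ] [Algebra Λ k] [FiniteDimensional k V]

/-- The object `k[V]` of `Art(Λ, k)`, for a finite-dimensional vector space `V`. -/
noncomputable def kv : ArtAlg Λ k where
  carrier := SqZero k V
  isLocalRing := by
    refine isLocalRing_of_unit (k := k)
      { toFun := SqZero.re, map_one' := rfl, map_mul' := SqZero.re_mul,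
        map_zero' := rfl, map_add' := SqZero.re_add } fun x (hx : x.re ≠ 0) => ?_
    refine IsUnit.of_mul_eq_one (SqZero.mk x.re⁻¹ (-(x.re⁻¹ * x.re⁻¹) • x.im)) ?_
    ext
    · simp [hx]
    · simp [smul_smul, hx]
  isArtinianRing := by
    let _ := (SqZero.inclHom k V).toAlgebra
    let e : (k × V) →ₗ[k] SqZero k V :=
      { toFun := fun x => SqZero.mk x.1 x.2
        map_add' := fun _ _ => rfl
        map_smul' := fun c x => by
          rw [Algebra.smul_def]
          change _ = SqZero.mk c 0 * _
          ext <;> simp }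
    have : Module.Finite k (SqZero k V) := Module.Finite.of_surjective e fun x => ⟨(x.re, x.im), rfl⟩
    exact IsArtinianRing.of_finite k (SqZero k V)
  π :=
    { toFun := SqZero.re, map_one' := rfl, map_mul' := SqZero.re_mul,
      map_zero' := rfl, map_add' := SqZero.re_add, commutes' := fun _ => rfl }

/-- The structure map `k → k[V]`. -/
noncomputable def kvIncl : base Λ k →ₐ[Λ] kv k V Λ :=
  { SqZero.inclHom k V with commutes' := fun _ => rfl }

variable {k V}

/-- The map `k[V] → k[W]` induced by a linear map `V → W`. -/
noncomputable def kvMap {W : Type u} [AddCommGroup W] [Module k W] [FiniteDimensional k W]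
    (h : V →ₗ[k] W) : kv k V Λ →ₐ[Λ] kv k W Λ where
  toFun := fun x : SqZero k V => SqZero.mk x.re (h x.im)
  map_one' := SqZero.ext rfl (map_zero h)
  map_mul' x y := SqZero.ext rfl (by
    change h (SqZero.re x • SqZero.im y + SqZero.re y • SqZero.im x) =
      SqZero.re x • h (SqZero.im y) + SqZero.re y • h (SqZero.im x)
    simp)
  map_zero' := SqZero.ext rfl (map_zero h)
  map_add' x y := SqZero.ext rfl (map_add h (SqZero.im x) (SqZero.im y))
  commutes' _ := SqZero.ext rfl (map_zero h)

end sqZero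

end ArtAlg

/-- `S`, with its functor `p` to `C`, is a category fibered in groupoids over `C`. -/
structure IsFiberedInGroupoids {C : Type*} {S : Type*} [Category C] [Category S]
    (p : S ⥤ C) : Prop where
  exists_pullback : ∀ {T T' : C} (f : T ⟶ T') (η' : p.Fiber T'),
    ∃ (η : p.Fiber T) (φ : η.1 ⟶ η'.1), p.IsHomLift f φ
  /-- Given `φ : η' → η''` over `T' → T''`, every `η → η''` over a composite `T → T' → T''` factors
  through a unique `η → η'` over `T → T'`. -/
  isStronglyCartesian : ∀ {η' η'' : S} (φ : η' ⟶ η''), p.IsStronglyCartesian (p.map φ) φ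

section fibers

variable {Λ k : Type u} [CommRing Λ] [Field k] [Algebra Λ k]
  {S : Type u₂} [Category.{v₂} S] (p : S ⥤ (ArtAlg Λ k)ᵒᵖ)

/-- The fiber category of `S` over `A`. -/
abbrev Fib (A : ArtAlg Λ k) := p.Fiber (op A)

/-- For a ring map `f : A' → A`, the morphisms `η → η'` of `S` over `f`, from an object over `A` to
an object over `A'`. In a category fibered in groupoids, such a morphism exhibits `η` as the
pushforward `f_* η' = η'|_A`. -/
abbrev HomOver {A' A : ArtAlg Λ k} (f : A' →ₐ[Λ] A) (η : Fib p A) (η' : Fib p A') :=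
  {φ : η.1 ⟶ η'.1 // p.IsHomLift (ArtAlg.arrow f) φ}

variable [CompleteLocalBase Λ k]

open ArtAlg in
/-- `p : S → Art(Λ, k)ᵒᵖ` is a deformation stack. -/
structure IsDeformationStack : Prop where
  fibered : IsFiberedInGroupoids p
  /-- the fiber over `k` is the trivial groupoid -/
  nonempty : Nonempty (Fib p (base Λ k))
  unique : ∀ a b : Fib p (base Λ k), Nonempty (Unique (a ⟶ b))
  /-- Morphisms form a sheaf. Here `ηᵢ, θᵢ` are restrictions of `η, θ` to `A'` (`i = 1`),
  `A''` (`i = 2`) and `A` (`i = 0`), and `φ₀` is the common restriction of `φ₁` and `φ₂`. -/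
  morphisms : ∀ {A' A'' A : ArtAlg Λ k} (p' : A' →ₐ[Λ] A) (p'' : A'' →ₐ[Λ] A),
    Function.Surjective p'' →
    ∀ {η θ : Fib p (fiberProd p' p'')} {η₁ θ₁ : Fib p A'} {η₂ θ₂ : Fib p A''} {η₀ θ₀ : Fib p A}
      (a₁ : HomOver p (fst p' p'') η₁ η) (a₂ : HomOver p (snd p' p'') η₂ η)
      (r₁ : HomOver p p' η₀ η₁) (r₂ : HomOver p p'' η₀ η₂)
      (b₁ : HomOver p (fst p' p'') θ₁ θ) (b₂ : HomOver p (snd p' p'') θ₂ θ)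
      (s₁ : HomOver p p' θ₀ θ₁) (s₂ : HomOver p p'' θ₀ θ₂),
      r₁.1 ≫ a₁.1 = r₂.1 ≫ a₂.1 → s₁.1 ≫ b₁.1 = s₂.1 ≫ b₂.1 →
      ∀ (φ₁ : η₁ ⟶ θ₁) (φ₂ : η₂ ⟶ θ₂) (φ₀ : η₀ ⟶ θ₀),
        φ₀.1 ≫ s₁.1 = r₁.1 ≫ φ₁.1 → φ₀.1 ≫ s₂.1 = r₂.1 ≫ φ₂.1 →
        ∃! φ : η ⟶ θ, a₁.1 ≫ φ.1 = φ₁.1 ≫ b₁.1 ∧ a₂.1 ≫ φ.1 = φ₂.1 ≫ b₂.1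
  /-- Objects satisfy effective descent. -/
  objects : ∀ {A' A'' A : ArtAlg Λ k} (p' : A' →ₐ[Λ] A) (p'' : A'' →ₐ[Λ] A),
    Function.Surjective p'' →
    ∀ {η' : Fib p A'} {η'' : Fib p A''} {η₁ η₂ : Fib p A}
      (r₁ : HomOver p p' η₁ η') (r₂ : HomOver p p'' η₂ η'') (φ : η₁ ⟶ η₂),
      ∃ (η : Fib p (fiberProd p' p'')) (a' : HomOver p (fst p' p'') η' η)
        (a'' : HomOver p (snd p' p'') η'' η), r₁.1 ≫ a'.1 = φ.1 ≫ r₂.1 ≫ a''.1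

/-- A choice of the object `ζ₀` over `k`, and of its pushforwards `ζ_V` to all `k[V]`. -/
structure TrivialObjects where
  ζ₀ : Fib p (ArtAlg.base Λ k)
  ζ : ∀ (V : Type u) [AddCommGroup V] [Module k V] [FiniteDimensional k V],
    Fib p (ArtAlg.kv k V Λ)
  toζ₀ : ∀ (V : Type u) [AddCommGroup V] [Module k V] [FiniteDimensional k V],
    HomOver p (ArtAlg.kvIncl k V Λ) (ζ V) ζ₀

/-- `T_V`: the set of isomorphism classes of the fiber over `k[V]`. -/
noncomputable def TangentSet (V : Type u) [AddCommGroup V] [Module k V] [FiniteDimensional k V] :=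
  Quotient (isIsomorphicSetoid (Fib p (ArtAlg.kv k V Λ)))

variable {p} in
/-- The class in `T_V` of an object over `k[V]`. -/
noncomputable def TangentSet.mk {V : Type u} [AddCommGroup V] [Module k V] [FiniteDimensional k V]
    (η : Fib p (ArtAlg.kv k V Λ)) : TangentSet p V :=
  Quotient.mk (isIsomorphicSetoid _) η

variable {p} in
/-- `A_V`: the automorphisms of `ζ_V` in the fiber over `k[V]`. -/
abbrev AutGrp (ζ : TrivialObjects p)
    (V : Type u) [AddCommGroup V] [Module k V] [FiniteDimensional k V] := Aut (ζ.ζ V)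

end fibers

section extensions

variable {Λ k : Type u} [CommRing Λ] [Field k] [Algebra Λ k] [CompleteLocalBase Λ k]

/-- The data making `f : A' → A` a small extension with kernel `V`: the map `f` is onto, and `ι`
identifies the `k`-vector space `V` with the kernel of `f`, which is killed by the maximal ideal
of `A'` (that is, `A'` acts on it through `π : A' → k`). -/
structure SmallExtension {A' A : ArtAlg Λ k} (f : A' →ₐ[Λ] A)
    (V : Type u) [AddCommGroup V] [Module k V] where
  surj : Function.Surjective f
  ι : V →+ A'
  ι_injective : Function.Injective ι
  ker_eq : ∀ x : A', f x = 0 ↔ ∃ v, ι v = x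
  mul_ι : ∀ (x : A') (v : V), x * ι v = ι (A'.π x • v)

open IsLocalRing in
/-- Every surjection whose kernel `I` satisfies `I · 𝔪 = 0` is a small extension in the above
sense, with `V = I` (and `I` is a finite-dimensional `k`-vector space). -/
theorem exists_smallExtension {A' A : ArtAlg Λ k} (f : A' →ₐ[Λ] A) (hf : Function.Surjective f)
    (hI : RingHom.ker f * maximalIdeal A' = ⊥) :
    ∃ (_ : Module k (RingHom.ker f)) (_ : FiniteDimensional k (RingHom.ker f))
      (E : SmallExtension f (RingHom.ker f)), ∀ x, E.ι x = x := by
  have h0 : ∀ (a : A') (x : RingHom.ker f), A'.π a = 0 → a • x = 0 := by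
    intro a x ha
    have : (x : A') * a ∈ RingHom.ker f * maximalIdeal A' :=
      Ideal.mul_mem_mul x.2 (ArtAlg.π_eq_zero_iff.1 ha)
    rw [hI, Ideal.mem_bot, mul_comm] at this
    exact Subtype.ext this
  have h1 : ∀ (a b : A') (x : RingHom.ker f), A'.π a = A'.π b → a • x = b • x := by
    intro a b x hab
    have := h0 (a - b) x (by rw [map_sub, hab, sub_self])
    rwa [sub_smul, sub_eq_zero] at this
  choose l hl using A'.π_surjective
  let M : Module k (RingHom.ker f) :=
    { smul := fun c x => l c • x
      one_smul := fun x => (h1 _ 1 x (by rw [hl, map_one])).trans (one_smul _ x)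
      mul_smul := fun c d x =>
        (h1 _ (l c * l d) x (by rw [map_mul, hl, hl, hl])).trans (mul_smul _ _ x)
      smul_zero := fun c => smul_zero (l c)
      smul_add := fun c x y => smul_add (l c) x y
      add_smul := fun c d x =>
        (h1 _ (l c + l d) x (by rw [map_add, hl, hl, hl])).trans (add_smul _ _ x)
      zero_smul := fun x => h0 _ x (hl 0) }
  have hM : ∀ (a : A') (x : RingHom.ker f), a • x = A'.π a • x := fun a x =>
    h1 a (l (A'.π a)) x (hl _).symm
  refine ⟨M, ?_, ⟨hf, (RingHom.ker f).subtype.toAddMonoidHom, Subtype.val_injective,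
    fun x => ⟨fun h => ⟨⟨x, h⟩, rfl⟩, ?_⟩, fun x v => congrArg Subtype.val (hM x v)⟩,
    fun x => rfl⟩
  · obtain ⟨s, hs⟩ := Module.Finite.fg_top (R := A') (M := RingHom.ker f)
    refine ⟨s, ?_⟩
    rw [eq_top_iff]
    intro x _
    have hx : x ∈ Submodule.span A' (s : Set (RingHom.ker f)) := hs ▸ Submodule.mem_top
    induction hx using Submodule.span_induction with
    | mem x h => exact Submodule.subset_span h
    | zero => exact Submodule.zero_mem _
    | add x y _ _ hx hy => exact Submodule.add_mem _ (hx trivial) (hy trivial)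
    | smul a x _ hx => rw [hM]; exact Submodule.smul_mem _ _ (hx trivial)
  · rintro ⟨v, rfl⟩
    exact v.2

namespace SmallExtension

variable {A' A : ArtAlg Λ k} {f : A' →ₐ[Λ] A} {V : Type u} [AddCommGroup V] [Module k V]

theorem π_ι (E : SmallExtension f V) (v : V) : A'.π (E.ι v) = 0 := by
  rw [← ArtAlg.π_comp f, (E.ker_eq _).2 ⟨v, rfl⟩, map_zero]

theorem ι_mul_ι (E : SmallExtension f V) (v w : V) : E.ι v * E.ι w = 0 := by
  rw [E.mul_ι, E.π_ι, zero_smul, map_zero]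

variable [FiniteDimensional k V]

variable (Λ V) in
/-- The small extension `k[V] → k` with kernel `V`. -/
noncomputable def triv : SmallExtension (ArtAlg.kv k V Λ).π (A := ArtAlg.base Λ k) V where
  surj := (ArtAlg.kv k V Λ).π_surjective
  ι := { toFun := fun v => ArtAlg.SqZero.mk 0 v
         map_zero' := rfl
         map_add' := fun v w => ArtAlg.SqZero.ext (add_zero (0 : k)).symm rfl }
  ι_injective := fun v w h => congrArg ArtAlg.SqZero.im h
  ker_eq := fun x =>
    ⟨fun h => ⟨ArtAlg.SqZero.im x, ArtAlg.SqZero.ext h.symm rfl⟩, by rintro ⟨v, rfl⟩; rfl⟩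
  mul_ι := fun x v => ArtAlg.SqZero.ext (mul_zero (ArtAlg.SqZero.re x)) (by
    change ArtAlg.SqZero.re x • v + (0 : k) • ArtAlg.SqZero.im x = ArtAlg.SqZero.re x • v
    simp)

/-- The object `A' ×_k k[V]`. -/
noncomputable abbrev prodKV (A' : ArtAlg Λ k) (V : Type u) [AddCommGroup V] [Module k V]
    [FiniteDimensional k V] : ArtAlg Λ k :=
  ArtAlg.fiberProd (A := ArtAlg.base Λ k) A'.π (ArtAlg.kv k V Λ).π

/-- The first projection `A' ×_k k[V] → A'`. -/
noncomputable abbrev p₁ (A' : ArtAlg Λ k) (V : Type u) [AddCommGroup V] [Module k V]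
    [FiniteDimensional k V] : prodKV A' V →ₐ[Λ] A' :=
  ArtAlg.fst (A := ArtAlg.base Λ k) A'.π (ArtAlg.kv k V Λ).π

/-- The second projection `A' ×_k k[V] → k[V]`. -/
noncomputable abbrev p₂ (A' : ArtAlg Λ k) (V : Type u) [AddCommGroup V] [Module k V]
    [FiniteDimensional k V] : prodKV A' V →ₐ[Λ] ArtAlg.kv k V Λ :=
  ArtAlg.snd (A := ArtAlg.base Λ k) A'.π (ArtAlg.kv k V Λ).π

/-- The map `A' → A' ×_k k[V]`, `x ↦ (x, π x + 0)`. -/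
noncomputable def incl (A' : ArtAlg Λ k) (V : Type u) [AddCommGroup V] [Module k V]
    [FiniteDimensional k V] : A' →ₐ[Λ] prodKV A' V :=
  ArtAlg.lift (A := ArtAlg.base Λ k) A'.π (ArtAlg.kv k V Λ).π (AlgHom.id Λ A')
    ((ArtAlg.kvIncl k V Λ).comp A'.π) (AlgHom.ext fun _ => rfl)

/-- The addition map `σ : A' ×_k k[V] → A'`, `(x, π x + v) ↦ x + v`. -/
noncomputable def σ (E : SmallExtension f V) : prodKV A' V →ₐ[Λ] A' where
  toFun z := z.1.1 + E.ι (ArtAlg.SqZero.im z.1.2)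
  map_one' := by
    change (1 : A') + E.ι 0 = 1
    rw [map_zero, add_zero]
  map_mul' := by
    rintro ⟨⟨x, a⟩, hx⟩ ⟨⟨y, b⟩, hy⟩
    have hx' : A'.π x = ArtAlg.SqZero.re a := hx
    have hy' : A'.π y = ArtAlg.SqZero.re b := hy
    change x * y + E.ι (ArtAlg.SqZero.re a • ArtAlg.SqZero.im b +
        ArtAlg.SqZero.re b • ArtAlg.SqZero.im a) =
      (x + E.ι (ArtAlg.SqZero.im a)) * (y + E.ι (ArtAlg.SqZero.im b))
    rw [map_add, ← hx', ← hy', ← E.mul_ι, ← E.mul_ι]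
    linear_combination -E.ι_mul_ι (ArtAlg.SqZero.im a) (ArtAlg.SqZero.im b)
  map_zero' := by
    change (0 : A') + E.ι 0 = 0
    rw [map_zero, add_zero]
  map_add' := by
    rintro ⟨⟨x, a⟩, hx⟩ ⟨⟨y, b⟩, hy⟩
    change x + y + E.ι (ArtAlg.SqZero.im a + ArtAlg.SqZero.im b) =
      (x + E.ι (ArtAlg.SqZero.im a)) + (y + E.ι (ArtAlg.SqZero.im b))
    rw [map_add]
    ring
  commutes' l := by
    change algebraMap Λ A' l + E.ι 0 = _
    rw [map_zero, add_zero]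

end SmallExtension

end extensions

section addition

variable {Λ k : Type u} [CommRing Λ] [Field k] [Algebra Λ k] [CompleteLocalBase Λ k]
  {S : Type u₂} [Category.{v₂} S] {p : S ⥤ (ArtAlg Λ k)ᵒᵖ}
  {A' A : ArtAlg Λ k} {f : A' →ₐ[Λ] A}
  {V : Type u} [AddCommGroup V] [Module k V] [FiniteDimensional k V]

open SmallExtension in
/-- A realization of the addition law `+_{A', V}`: a functor sending `(η₁, η₂)` to a pushforward
under `σ` of an object `η₁ * η₂` over `A' ×_k k[V]` whose restrictions to `A'` and `k[V]` are
`η₁` and `η₂`, and acting on morphisms accordingly. -/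
structure AdditionLaw (ζ : TrivialObjects p) (E : SmallExtension f V) where
  /-- the functor `+_{A', V}` -/
  functor : Fib p A' × Fib p (ArtAlg.kv k V Λ) ⥤ Fib p A'
  /-- the object `η₁ * η₂` -/
  star : Fib p A' → Fib p (ArtAlg.kv k V Λ) → Fib p (prodKV A' V)
  q₁ : ∀ η₁ η₂, HomOver p (p₁ A' V) η₁ (star η₁ η₂)
  q₂ : ∀ η₁ η₂, HomOver p (p₂ A' V) η₂ (star η₁ η₂)
  /-- the map exhibiting `η₁ + η₂` as `σ_* (η₁ * η₂)` -/
  push : ∀ η₁ η₂, HomOver p E.σ (functor.obj (η₁, η₂)) (star η₁ η₂)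
  /-- `f₁ + f₂` is the pushforward of a morphism `f₁ * f₂` restricting to `f₁` and `f₂` -/
  map_spec : ∀ {η₁ θ₁ : Fib p A'} {η₂ θ₂ : Fib p (ArtAlg.kv k V Λ)} (f₁ : η₁ ⟶ θ₁) (f₂ : η₂ ⟶ θ₂),
    ∃ h : star η₁ η₂ ⟶ star θ₁ θ₂,
      (q₁ η₁ η₂).1 ≫ h.1 = f₁.1 ≫ (q₁ θ₁ θ₂).1 ∧
      (q₂ η₁ η₂).1 ≫ h.1 = f₂.1 ≫ (q₂ θ₁ θ₂).1 ∧
      (functor.map (X := (η₁, η₂)) (Y := (θ₁, θ₂)) (Prod.mkHom f₁ f₂)).1 ≫ (push θ₁ θ₂).1 =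
        (push η₁ η₂).1 ≫ h.1
  /-- the canonical identification of `η + ζ_V` with `η` -/
  unit : ∀ η, functor.obj (η, ζ.ζ V) ⟶ η
  /-- the identification comes from the map `c` which realizes `η * ζ_V` as the pushforward of `η`
  under `incl` in such a way that `q₁` and `q₂` become the identity of `η` and the canonical map
  `ζ_V → ζ₀ → η` -/
  unit_spec : ∀ η, ∃ (z : HomOver p (A := ArtAlg.base Λ k) A'.π ζ.ζ₀ η)
    (c : HomOver p (incl A' V) (star η (ζ.ζ V)) η),
      (q₁ η (ζ.ζ V)).1 ≫ c.1 = 𝟙 η.1 ∧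
      (q₂ η (ζ.ζ V)).1 ≫ c.1 = (ζ.toζ₀ V).1 ≫ z.1 ∧
      (unit η).1 = (push η (ζ.ζ V)).1 ≫ c.1

namespace AdditionLaw

variable {ζ : TrivialObjects p} {E : SmallExtension f V} (L : AdditionLaw ζ E)

/-- The sum `η₁ + η₂` of objects. -/
noncomputable def add (η₁ : Fib p A') (η₂ : Fib p (ArtAlg.kv k V Λ)) : Fib p A' := L.functor.obj (η₁, η₂)

/-- The sum `f₁ + f₂` of morphisms. -/
noncomputable def addHom {η₁ θ₁ : Fib p A'} {η₂ θ₂ : Fib p (ArtAlg.kv k V Λ)} (f₁ : η₁ ⟶ θ₁) (f₂ : η₂ ⟶ θ₂) :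
    L.add η₁ η₂ ⟶ L.add θ₁ θ₂ :=
  L.functor.map (X := (η₁, η₂)) (Y := (θ₁, θ₂)) (Prod.mkHom f₁ f₂)

end AdditionLaw

/-- A lift of `η` to `A'`: a pair of an object `η'` over `A'` and a map `η → η'` over `A' → A`. -/
structure LiftPair (E : SmallExtension f V) (η : Fib p A) where
  obj : Fib p A'
  map : HomOver p f η obj

/-- Isomorphism of lifts: an isomorphism of the objects over `A'` compatible with the maps. -/
instance LiftPair.setoid (E : SmallExtension f V) (η : Fib p A) : Setoid (LiftPair E η) where
  r x y := ∃ ψ : x.obj ≅ y.obj, x.map.1 ≫ ψ.hom.1 = y.map.1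
  iseqv :=
    { refl := fun x => ⟨Iso.refl _, Category.comp_id _⟩
      symm := by
        rintro x y ⟨ψ, h⟩
        refine ⟨ψ.symm, ?_⟩
        have h2 : ψ.hom.1 ≫ ψ.inv.1 = 𝟙 x.obj.1 := congrArg Subtype.val ψ.hom_inv_id
        change y.map.1 ≫ ψ.inv.1 = _
        rw [← h, Category.assoc, h2, Category.comp_id]
      trans := by
        rintro x y z ⟨ψ, h⟩ ⟨χ, h'⟩
        refine ⟨ψ ≪≫ χ, ?_⟩
        change x.map.1 ≫ ψ.hom.1 ≫ χ.hom.1 = _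
        rw [← Category.assoc, h, h'] }

/-- `T_{η, A'}`: the set of isomorphism classes of lifts of `η` to `A'`. -/
def Lifts (E : SmallExtension f V) (η : Fib p A) := Quotient (LiftPair.setoid E η)

/-- The class of a lift in `T_{η, A'}`. -/
def Lifts.mk {E : SmallExtension f V} {η : Fib p A} (x : LiftPair E η) : Lifts E η :=
  Quotient.mk _ x

/-- `A_{φ, η'}`: the automorphisms of `η'` restricting to the automorphism `φ` of `η'|_A = η₀`,
where the restriction is exhibited by `r : η₀ → η'`. -/
def AutLifts (_E : SmallExtension f V) {η₀ : Fib p A} {η' : Fib p A'} (r : HomOver p f η₀ η')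
    (φ : Aut η₀) := {φ' : Aut η' // φ.hom.1 ≫ r.1 = r.1 ≫ φ'.hom.1}

/-- `A_{id, η'}`, as a subgroup of the group of automorphisms of `η'` under composition. -/
def autLiftsId {η₀ : Fib p A} {η' : Fib p A'} (r : HomOver p f η₀ η') : Subgroup (Aut η') where
  carrier := {φ' | (𝟙 η₀ : η₀ ⟶ η₀).1 ≫ r.1 = r.1 ≫ φ'.hom.1}
  one_mem' := (Category.id_comp _).trans (Category.comp_id _).symm
  mul_mem' {a b} ha hb := by
    change 𝟙 η₀.1 ≫ r.1 = r.1 ≫ a.hom.1 at ha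
    change 𝟙 η₀.1 ≫ r.1 = r.1 ≫ b.hom.1 at hb
    change 𝟙 η₀.1 ≫ r.1 = r.1 ≫ b.hom.1 ≫ a.hom.1
    rw [← Category.assoc, ← hb, Category.id_comp, ← ha, Category.id_comp]
  inv_mem' {a} ha := by
    change 𝟙 η₀.1 ≫ r.1 = r.1 ≫ a.hom.1 at ha
    change 𝟙 η₀.1 ≫ r.1 = r.1 ≫ a.inv.1
    have h : a.hom.1 ≫ a.inv.1 = 𝟙 η'.1 := congrArg Subtype.val a.hom_inv_id
    rw [Category.id_comp] at ha ⊢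
    nth_rewrite 2 [ha]
    rw [Category.assoc, h, Category.comp_id]

/-- `X` is a pseudotorsor under `G`: it is empty, or a torsor, i.e. `G` acts simply transitively
on the nonempty set `X`. -/
def IsPseudotorsor (G X : Type*) [AddGroup G] [AddAction G X] : Prop :=
  IsEmpty X ∨ (Nonempty X ∧ ∀ x y : X, ∃! g : G, g +ᵥ x = y)

end addition

/-! Everything rests on one ring isomorphism. For a small extension `f : A' → A` with kernel `V`,
the pair `(p₁, σ)` identifies `A' ×_k k[V]` with `A' ×_A A'`: a pair `(x, y)` with `f x = f y` is
the same as `x` together with the vector `y - x` in `V`. An object `ω` over this ring can therefore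
be read in two ways. Over `k` it is an arbitrary pair of an object over `A'` and an object over
`k[V]`, because the fiber over `k` is trivial and gluing there needs no compatibility. Over `A` it
is a pair of objects over `A'` with an identification of their restrictions to `A`. Passing from the
first reading to the second adds a tangent vector to a lift; passing back takes the difference of
two lifts. Both passages exist and respect isomorphism, which is simple transitivity
(`isFiberSquare_σ`, `IsSum.exists_sum`, `IsSum.exists_difference`).

The same argument for morphisms `ω → ω` shows that `ψ ↦ id + ψ` is a bijection from `A_V` to `A_{id,
η'}`. Functoriality of `+` is the interchange law (`IsAutSum.mul`). It makes this bijection a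
homomorphism and, by Eckmann–Hilton, makes addition on `A_V` equal to composition and commutative
(`autGrp_mul_comm`). A set `A_{φ, η'}`, if nonempty, is a coset of `A_{id, η'}`.

The group axioms, the action axioms and functoriality come from identities of ring maps:
`σ_triv_comp_swap`, `σ_assoc`, `σ_comp_incl`, `σ_comp_prodMap`. Sums are handled as relations,
`IsSum` and `IsAutSum`, rather than through a chosen addition law, so the resulting structures agree
with every such law at once. -/

/-! ### Pushforwards and cancellation in a category fibered in groupoids -/

section pushforward

variable {Λ k : Type u} [CommRing Λ] [Field k] [Algebra Λ k]
  {S : Type u₂} [Category.{v₂} S] {p : S ⥤ (ArtAlg Λ k)ᵒᵖ}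

namespace HomOver

/-- The composite of morphisms over `f : A' → A` and `g : A → B`. -/
def comp {A' A B : ArtAlg Λ k} {f : A' →ₐ[Λ] A} {g : A →ₐ[Λ] B} {e : A' →ₐ[Λ] B}
    {η' : Fib p A'} {η : Fib p A} {θ : Fib p B} (t : HomOver p g θ η) (r : HomOver p f η η')
    (he : g.comp f = e) : HomOver p e θ η' :=
  ⟨t.1 ≫ r.1, by
    have := t.2
    have := r.2
    subst he
    exact (inferInstance : p.IsHomLift (ArtAlg.arrow g ≫ ArtAlg.arrow f) (t.1 ≫ r.1))⟩

/-- A morphism of a fiber category, seen as a morphism over the identity. -/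
def ofFiber {A : ArtAlg Λ k} {η θ : Fib p A} (φ : η ⟶ θ) : HomOver p (AlgHom.id Λ A) η θ :=
  ⟨φ.1, φ.2⟩

/-- A morphism over the identity, seen as a morphism of a fiber category. -/
def toFiber {A : ArtAlg Λ k} {η θ : Fib p A} {f : A →ₐ[Λ] A} (φ : HomOver p f η θ)
    (hf : f = AlgHom.id Λ A) : η ⟶ θ :=
  ⟨φ.1, by subst hf; exact φ.2⟩

/-- Precomposition with a morphism of a fiber category. -/
def precomp {A' A : ArtAlg Λ k} {f : A' →ₐ[Λ] A} {η' : Fib p A'} {η θ : Fib p A} (φ : θ ⟶ η)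
    (r : HomOver p f η η') : HomOver p f θ η' :=
  (ofFiber φ).comp r (AlgHom.id_comp f)

/-- Postcomposition with a morphism of a fiber category. -/
def postcomp {A' A : ArtAlg Λ k} {f : A' →ₐ[Λ] A} {η' θ' : Fib p A'} {η : Fib p A}
    (r : HomOver p f η η') (φ : η' ⟶ θ') : HomOver p f η θ' :=
  r.comp (ofFiber φ) (AlgHom.comp_id f)

end HomOver

theorem fib_comp_val {A : ArtAlg Λ k} {η θ ξ : Fib p A} (φ : η ⟶ θ) (ψ : θ ⟶ ξ) :
    (φ ≫ ψ).1 = φ.1 ≫ ψ.1 := rfl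

theorem fib_id_val {A : ArtAlg Λ k} (η : Fib p A) : (𝟙 η : η ⟶ η).1 = 𝟙 η.1 := rfl

/-- A fiber object lies over its base object only up to a propositional equality, so a morphism over
`f` has `q.map φ` equal to `f` only up to transport. Case analysis on `IsHomLift` removes the
transport. -/
theorem isStronglyCartesian_of_isHomLift {C D : Type*} [Category C] [Category D] {q : D ⥤ C}
    {a b : D} {φ : a ⟶ b} (h : q.IsStronglyCartesian (q.map φ) φ) {R T : C} (f : R ⟶ T)
    [hf : q.IsHomLift f φ] : q.IsStronglyCartesian f φ := by
  obtain ⟨⟩ := hf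
  exact h

namespace IsFiberedInGroupoids

variable (hS : IsFiberedInGroupoids p) {A' A B : ArtAlg Λ k}
include hS

theorem exists_pushforward (f : A' →ₐ[Λ] A) (η' : Fib p A') :
    ∃ η : Fib p A, Nonempty (HomOver p f η η') := by
  obtain ⟨η, φ, h⟩ := hS.exists_pullback (ArtAlg.arrow f) η'
  exact ⟨η, ⟨φ, h⟩⟩

/-- The cartesian property in terms of ring maps. The composite is a separate variable `e`, so that
an identity between ring maps can be supplied where the map at hand is not literally a composite. -/
theorem existsUnique_factor {f : A' →ₐ[Λ] A} {g : A →ₐ[Λ] B} {e : A' →ₐ[Λ] B}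
    {η' : Fib p A'} {η : Fib p A} {θ : Fib p B} (r : HomOver p f η η') (s : HomOver p e θ η')
    (he : g.comp f = e) :
    ∃! t : θ.1 ⟶ η.1, p.IsHomLift (ArtAlg.arrow g) t ∧ t ≫ r.1 = s.1 := by
  subst he
  have := r.2
  have := s.2
  have := isStronglyCartesian_of_isHomLift (hS.isStronglyCartesian r.1) (ArtAlg.arrow f)
  exact Functor.IsStronglyCartesian.universal_property p (ArtAlg.arrow f) r.1 (ArtAlg.arrow g)
    (ArtAlg.arrow (g.comp f)) rfl s.1

theorem exists_factor {f : A' →ₐ[Λ] A} {g : A →ₐ[Λ] B} {e : A' →ₐ[Λ] B}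
    {η' : Fib p A'} {η : Fib p A} {θ : Fib p B} (r : HomOver p f η η') (s : HomOver p e θ η')
    (he : g.comp f = e) : ∃ t : HomOver p g θ η, t.1 ≫ r.1 = s.1 := by
  obtain ⟨t, ⟨h, h'⟩, -⟩ := hS.existsUnique_factor r s he
  exact ⟨⟨t, h⟩, h'⟩

/-- The uniqueness half of the cartesian property. It reduces an equation between morphisms into a
pushforward to an equation in the object that was pushed forward, provided that both sides lie over
the same ring map. -/
theorem cancel {f : A' →ₐ[Λ] A} {g : A →ₐ[Λ] B} {η' : Fib p A'} {η : Fib p A} {θ : Fib p B}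
    (r : HomOver p f η η') (t t' : HomOver p g θ η) (h : t.1 ≫ r.1 = t'.1 ≫ r.1) : t = t' :=
  Subtype.ext ((hS.existsUnique_factor r (t'.comp r rfl) rfl).unique ⟨t.2, h⟩ ⟨t'.2, rfl⟩)

theorem exists_fiber_factor {f : A' →ₐ[Λ] A} {η' : Fib p A'} {η θ : Fib p A}
    (r : HomOver p f η η') (s : HomOver p f θ η') : ∃ t : θ ⟶ η, t.1 ≫ r.1 = s.1 := by
  obtain ⟨t, ht⟩ := hS.exists_factor r s (AlgHom.id_comp f)
  exact ⟨t.toFiber rfl, ht⟩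

theorem fiber_cancel {f : A' →ₐ[Λ] A} {η' : Fib p A'} {η θ : Fib p A}
    (r : HomOver p f η η') (t t' : θ ⟶ η) (h : t.1 ≫ r.1 = t'.1 ≫ r.1) : t = t' :=
  Subtype.ext (congrArg Subtype.val
    (hS.cancel r (HomOver.ofFiber t) (HomOver.ofFiber t') h) :)

theorem isIso_fiber {η θ : Fib p A} (φ : η ⟶ θ) : IsIso φ := by
  -- Since `φ` is itself cartesian, the identity of `θ` factors through it. This one-sided inverse
  -- is two-sided because `φ` can be cancelled on the right.
  obtain ⟨t, ht⟩ := hS.exists_fiber_factor (HomOver.ofFiber φ) (HomOver.ofFiber (𝟙 θ))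
  have h : t ≫ φ = 𝟙 θ := Subtype.ext ht
  refine ⟨t, hS.fiber_cancel (HomOver.ofFiber φ) _ _ ?_, h⟩
  change (φ.1 ≫ t.1) ≫ φ.1 = 𝟙 η.1 ≫ φ.1
  rw [Category.assoc]
  have h' : t.1 ≫ φ.1 = 𝟙 θ.1 := ht
  rw [h', Category.comp_id, Category.id_comp]

/-- The isomorphism given by a morphism of a fiber category. -/
noncomputable def isoOfHom {η θ : Fib p A} (φ : η ⟶ θ) : η ≅ θ :=
  haveI := hS.isIso_fiber φ
  asIso φ

end IsFiberedInGroupoids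

end pushforward

/-! ### Gluing along fiber squares, in particular over the residue field -/

section gluing

variable {Λ k : Type u} [CommRing Λ] [Field k] [Algebra Λ k] [CompleteLocalBase Λ k]
  {S : Type u₂} [Category.{v₂} S] {p : S ⥤ (ArtAlg Λ k)ᵒᵖ}

/-- The square of `a : C → A'`, `b : C → A''` over `f : A' → A`, `g : A'' → A` is a fiber square
with `g` surjective. -/
structure IsFiberSquare {C A' A'' A : ArtAlg Λ k} (a : C →ₐ[Λ] A') (b : C →ₐ[Λ] A'')
    (f : A' →ₐ[Λ] A) (g : A'' →ₐ[Λ] A) : Prop where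
  comm : f.comp a = g.comp b
  surj : Function.Surjective g
  injective : ∀ z z' : C, a z = a z' → b z = b z' → z = z'
  exists_eq : ∀ x y, f x = g y → ∃ z, a z = x ∧ b z = y

theorem isFiberSquare_fiberProd {A' A'' A : ArtAlg Λ k} (f : A' →ₐ[Λ] A) (g : A'' →ₐ[Λ] A)
    (hg : Function.Surjective g) : IsFiberSquare (ArtAlg.fst f g) (ArtAlg.snd f g) f g where
  comm := AlgHom.ext fun z => z.2
  surj := hg
  injective _ _ h h' := Subtype.ext (Prod.ext h h')
  exists_eq x y h := ⟨⟨(x, y), h⟩, rfl, rfl⟩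

namespace IsFiberSquare

variable {C A' A'' A : ArtAlg Λ k} {a : C →ₐ[Λ] A'} {b : C →ₐ[Λ] A''} {f : A' →ₐ[Λ] A}
  {g : A'' →ₐ[Λ] A}

/-- The isomorphism of the upper left corner of a fiber square with the fiber product. -/
noncomputable def equiv (h : IsFiberSquare a b f g) : C ≃ₐ[Λ] ArtAlg.fiberProd f g :=
  AlgEquiv.ofBijective (ArtAlg.lift f g a b h.comm)
    ⟨fun z z' e => h.injective z z' (congrArg (ArtAlg.fst f g) e) (congrArg (ArtAlg.snd f g) e),
      fun w => by
        obtain ⟨z, h₁, h₂⟩ := h.exists_eq _ _ w.2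
        exact ⟨z, Subtype.ext (Prod.ext h₁ h₂)⟩⟩

theorem fst_equiv (h : IsFiberSquare a b f g) :
    (ArtAlg.fst f g).comp (h.equiv : C →ₐ[Λ] ArtAlg.fiberProd f g) = a := rfl

theorem snd_equiv (h : IsFiberSquare a b f g) :
    (ArtAlg.snd f g).comp (h.equiv : C →ₐ[Λ] ArtAlg.fiberProd f g) = b := rfl

theorem comp_symm (h : IsFiberSquare a b f g) :
    a.comp (h.equiv.symm : ArtAlg.fiberProd f g →ₐ[Λ] C) = ArtAlg.fst f g :=
  AlgHom.ext fun z => congrArg (ArtAlg.fst f g) (h.equiv.apply_symm_apply z)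

theorem comp_symm' (h : IsFiberSquare a b f g) :
    b.comp (h.equiv.symm : ArtAlg.fiberProd f g →ₐ[Λ] C) = ArtAlg.snd f g :=
  AlgHom.ext fun z => congrArg (ArtAlg.snd f g) (h.equiv.apply_symm_apply z)

/-- Objects over the corners of a fiber square glue. -/
theorem exists_glue (h : IsFiberSquare a b f g) (hp : IsDeformationStack p)
    {η₁ : Fib p A'} {η₂ : Fib p A''} {η₀ : Fib p A} (r₁ : HomOver p f η₀ η₁)
    (r₂ : HomOver p g η₀ η₂) : ∃ (η : Fib p C) (a₁ : HomOver p a η₁ η) (a₂ : HomOver p b η₂ η),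
      r₁.1 ≫ a₁.1 = r₂.1 ≫ a₂.1 := by
  obtain ⟨η, a₁, a₂, e⟩ := hp.objects f g h.surj r₁ r₂ (𝟙 η₀)
  obtain ⟨θ, ⟨m⟩⟩ := hp.fibered.exists_pushforward
    (h.equiv.symm : ArtAlg.fiberProd f g →ₐ[Λ] C) η
  obtain ⟨b₁, h₁⟩ := hp.fibered.exists_factor m a₁ h.comp_symm
  obtain ⟨b₂, h₂⟩ := hp.fibered.exists_factor m a₂ h.comp_symm'
  refine ⟨θ, b₁, b₂, congrArg Subtype.val (hp.fibered.cancel m (r₁.comp b₁ rfl)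
    (r₂.comp b₂ h.comm.symm) ?_)⟩
  change (r₁.1 ≫ b₁.1) ≫ m.1 = (r₂.1 ≫ b₂.1) ≫ m.1
  rw [Category.assoc, Category.assoc, h₁, h₂, e, fib_id_val, Category.id_comp]

/-- Morphisms between the restrictions to the corners of a fiber square glue uniquely. -/
theorem existsUnique_hom (h : IsFiberSquare a b f g) (hp : IsDeformationStack p)
    {η θ : Fib p C} {η₁ θ₁ : Fib p A'} {η₂ θ₂ : Fib p A''} {η₀ θ₀ : Fib p A}
    (a₁ : HomOver p a η₁ η) (a₂ : HomOver p b η₂ η)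
    (r₁ : HomOver p f η₀ η₁) (r₂ : HomOver p g η₀ η₂)
    (b₁ : HomOver p a θ₁ θ) (b₂ : HomOver p b θ₂ θ)
    (s₁ : HomOver p f θ₀ θ₁) (s₂ : HomOver p g θ₀ θ₂)
    (hr : r₁.1 ≫ a₁.1 = r₂.1 ≫ a₂.1) (hs : s₁.1 ≫ b₁.1 = s₂.1 ≫ b₂.1)
    (φ₁ : η₁ ⟶ θ₁) (φ₂ : η₂ ⟶ θ₂) (φ₀ : η₀ ⟶ θ₀)
    (h₁ : φ₀.1 ≫ s₁.1 = r₁.1 ≫ φ₁.1) (h₂ : φ₀.1 ≫ s₂.1 = r₂.1 ≫ φ₂.1) :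
    ∃! φ : η ⟶ θ, a₁.1 ≫ φ.1 = φ₁.1 ≫ b₁.1 ∧ a₂.1 ≫ φ.1 = φ₂.1 ≫ b₂.1 := by
  have hS := hp.fibered
  -- Transport to the literal fiber product, where the stack axiom applies: as `h.equiv` is
  -- invertible, the map from a pushforward `ξ'` back to `ξ` has a section `n'` over the inverse
  -- ring map.
  have key : ∀ ξ : Fib p C, ∃ (ξ' : Fib p (ArtAlg.fiberProd f g))
      (n : HomOver p (h.equiv : C →ₐ[Λ] ArtAlg.fiberProd f g) ξ' ξ)
      (n' : HomOver p (h.equiv.symm : ArtAlg.fiberProd f g →ₐ[Λ] C) ξ ξ'),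
      n'.1 ≫ n.1 = 𝟙 ξ.1 := by
    intro ξ
    obtain ⟨ξ', ⟨n⟩⟩ := hS.exists_pushforward (h.equiv : C →ₐ[Λ] ArtAlg.fiberProd f g) ξ
    obtain ⟨n', e⟩ := hS.exists_factor n (HomOver.ofFiber (𝟙 ξ))
      (g := (h.equiv.symm : ArtAlg.fiberProd f g →ₐ[Λ] C))
      (AlgHom.ext fun z => h.equiv.symm_apply_apply z)
    exact ⟨ξ', n, n', e⟩
  obtain ⟨η', n, n', hn⟩ := key η
  obtain ⟨θ', m, m', hm⟩ := key θ
  obtain ⟨α₁, hα₁⟩ := hS.exists_factor n a₁ h.fst_equiv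
  obtain ⟨α₂, hα₂⟩ := hS.exists_factor n a₂ h.snd_equiv
  obtain ⟨β₁, hβ₁⟩ := hS.exists_factor m b₁ h.fst_equiv
  obtain ⟨β₂, hβ₂⟩ := hS.exists_factor m b₂ h.snd_equiv
  have comm := (isFiberSquare_fiberProd f g h.surj).comm
  have hrα : r₁.1 ≫ α₁.1 = r₂.1 ≫ α₂.1 :=
    congrArg Subtype.val (hS.cancel n (r₁.comp α₁ rfl) (r₂.comp α₂ comm.symm)
      (by change (r₁.1 ≫ α₁.1) ≫ n.1 = (r₂.1 ≫ α₂.1) ≫ n.1; simp [hα₁, hα₂, hr]))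
  have hsβ : s₁.1 ≫ β₁.1 = s₂.1 ≫ β₂.1 :=
    congrArg Subtype.val (hS.cancel m (s₁.comp β₁ rfl) (s₂.comp β₂ comm.symm)
      (by change (s₁.1 ≫ β₁.1) ≫ m.1 = (s₂.1 ≫ β₂.1) ≫ m.1; simp [hβ₁, hβ₂, hs]))
  have hαn : a₁.1 ≫ n'.1 = α₁.1 :=
    congrArg Subtype.val (hS.cancel n (a₁.comp n' h.comp_symm) α₁
      (by change (a₁.1 ≫ n'.1) ≫ n.1 = α₁.1 ≫ n.1; simp [hα₁, hn]))
  have hαn' : a₂.1 ≫ n'.1 = α₂.1 :=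
    congrArg Subtype.val (hS.cancel n (a₂.comp n' h.comp_symm') α₂
      (by change (a₂.1 ≫ n'.1) ≫ n.1 = α₂.1 ≫ n.1; simp [hα₂, hn]))
  have hβm : b₁.1 ≫ m'.1 = β₁.1 :=
    congrArg Subtype.val (hS.cancel m (b₁.comp m' h.comp_symm) β₁
      (by change (b₁.1 ≫ m'.1) ≫ m.1 = β₁.1 ≫ m.1; simp [hβ₁, hm]))
  have hβm' : b₂.1 ≫ m'.1 = β₂.1 :=
    congrArg Subtype.val (hS.cancel m (b₂.comp m' h.comp_symm') β₂
      (by change (b₂.1 ≫ m'.1) ≫ m.1 = β₂.1 ≫ m.1; simp [hβ₂, hm]))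
  obtain ⟨φ, ⟨e₁, e₂⟩, huniq⟩ := hp.morphisms f g h.surj α₁ α₂ r₁ r₂ β₁ β₂ s₁ s₂ hrα hsβ
    φ₁ φ₂ φ₀ h₁ h₂
  refine ⟨((n'.postcomp φ).comp m (e := AlgHom.id Λ C) (AlgHom.ext fun z => h.equiv.symm_apply_apply z)).toFiber rfl,
    ⟨?_, ?_⟩, fun ψ hψ => Subtype.ext ?_⟩
  · change a₁.1 ≫ (n'.1 ≫ φ.1) ≫ m.1 = _
    rw [Category.assoc, reassoc_of% hαn, reassoc_of% e₁, hβ₁]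
  · change a₂.1 ≫ (n'.1 ≫ φ.1) ≫ m.1 = _
    rw [Category.assoc, reassoc_of% hαn', reassoc_of% e₂, hβ₂]
  -- A competitor `ψ` over `C` is conjugated to the fiber product, where uniqueness identifies it
  -- with `φ`.
  · have := congrArg Subtype.val (huniq (((n.postcomp ψ).comp m' (e := AlgHom.id Λ _)
      (AlgHom.ext fun z => h.equiv.apply_symm_apply z)).toFiber rfl) ⟨?_, ?_⟩)
    · change (n.1 ≫ ψ.1) ≫ m'.1 = φ.1 at this
      change ψ.1 = (n'.1 ≫ φ.1) ≫ m.1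
      rw [← this]
      simp [hm, reassoc_of% hn]
    · change α₁.1 ≫ (n.1 ≫ ψ.1) ≫ m'.1 = _
      rw [Category.assoc, reassoc_of% hα₁, reassoc_of% hψ.1, hβm]
    · change α₂.1 ≫ (n.1 ≫ ψ.1) ≫ m'.1 = _
      rw [Category.assoc, reassoc_of% hα₂, reassoc_of% hψ.2, hβm']

end IsFiberSquare

namespace IsDeformationStack

variable (hp : IsDeformationStack p) {A : ArtAlg Λ k}
include hp

theorem hom_base_unique {θ₀ η₀ : Fib p (ArtAlg.base Λ k)} (t t' : θ₀ ⟶ η₀) : t = t' := by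
  obtain ⟨u⟩ := hp.unique θ₀ η₀
  exact Subsingleton.elim t t'

theorem exists_toBase (θ₀ : Fib p (ArtAlg.base Λ k)) (f : A →ₐ[Λ] ArtAlg.base Λ k) (η : Fib p A) :
    Nonempty (HomOver p f θ₀ η) := by
  obtain ⟨η₀, ⟨r⟩⟩ := hp.fibered.exists_pushforward f η
  obtain ⟨u⟩ := hp.unique θ₀ η₀
  exact ⟨r.precomp u.default⟩

/-- Two such maps differ by a morphism in the fiber over `k`, which is an identity. Hence every
compatibility condition over `k` in the gluing axioms holds automatically. -/
theorem toBase_unique {θ₀ : Fib p (ArtAlg.base Λ k)} {f : A →ₐ[Λ] ArtAlg.base Λ k} {η : Fib p A}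
    (t t' : HomOver p f θ₀ η) : t = t' := by
  obtain ⟨u, hu⟩ := hp.fibered.exists_fiber_factor t' t
  rw [hp.hom_base_unique u (𝟙 θ₀), fib_id_val, Category.id_comp] at hu
  exact Subtype.ext hu.symm

variable {C A' A'' : ArtAlg Λ k} {a : C →ₐ[Λ] A'} {b : C →ₐ[Λ] A''}
  {f : A' →ₐ[Λ] ArtAlg.base Λ k} {g : A'' →ₐ[Λ] ArtAlg.base Λ k}

/-- Objects glue along a fiber square over the residue field. -/
theorem exists_star (h : IsFiberSquare a b f g) (η₁ : Fib p A') (η₂ : Fib p A'') :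
    ∃ η : Fib p C, Nonempty (HomOver p a η₁ η) ∧ Nonempty (HomOver p b η₂ η) := by
  obtain ⟨θ⟩ := hp.nonempty
  obtain ⟨r₁⟩ := hp.exists_toBase θ f η₁
  obtain ⟨r₂⟩ := hp.exists_toBase θ g η₂
  obtain ⟨η, a₁, a₂, -⟩ := h.exists_glue hp r₁ r₂
  exact ⟨η, ⟨a₁⟩, ⟨a₂⟩⟩

/-- Morphisms glue uniquely along a fiber square over the residue field. -/
theorem existsUnique_starHom (h : IsFiberSquare a b f g)
    {η θ : Fib p C} {η₁ θ₁ : Fib p A'} {η₂ θ₂ : Fib p A''}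
    (a₁ : HomOver p a η₁ η) (a₂ : HomOver p b η₂ η)
    (b₁ : HomOver p a θ₁ θ) (b₂ : HomOver p b θ₂ θ) (φ₁ : η₁ ⟶ θ₁) (φ₂ : η₂ ⟶ θ₂) :
    ∃! φ : η ⟶ θ, a₁.1 ≫ φ.1 = φ₁.1 ≫ b₁.1 ∧ a₂.1 ≫ φ.1 = φ₂.1 ≫ b₂.1 := by
  obtain ⟨ξ⟩ := hp.nonempty
  obtain ⟨r₁⟩ := hp.exists_toBase ξ f η₁
  obtain ⟨r₂⟩ := hp.exists_toBase ξ g η₂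
  obtain ⟨s₁⟩ := hp.exists_toBase ξ f θ₁
  obtain ⟨s₂⟩ := hp.exists_toBase ξ g θ₂
  refine h.existsUnique_hom hp a₁ a₂ r₁ r₂ b₁ b₂ s₁ s₂ ?_ ?_ φ₁ φ₂ (𝟙 ξ) ?_ ?_
  · exact congrArg Subtype.val
      (hp.toBase_unique (r₁.comp a₁ rfl) (r₂.comp a₂ h.comm.symm))
  · exact congrArg Subtype.val
      (hp.toBase_unique (s₁.comp b₁ rfl) (s₂.comp b₂ h.comm.symm))
  · exact congrArg Subtype.val (hp.toBase_unique (s₁.precomp (𝟙 ξ)) (r₁.postcomp φ₁))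
  · exact congrArg Subtype.val (hp.toBase_unique (s₂.precomp (𝟙 ξ)) (r₂.postcomp φ₂))

end IsDeformationStack

end gluing

/-! ### The ring maps behind the addition law -/

section rings

variable {Λ k : Type u} [CommRing Λ] [Field k] [Algebra Λ k] [CompleteLocalBase Λ k]

namespace SmallExtension

variable {C A' A B' B : ArtAlg Λ k} {f : A' →ₐ[Λ] A} {f₂ : B' →ₐ[Λ] B}
  {V : Type u} [AddCommGroup V] [Module k V] [FiniteDimensional k V]
  {W : Type u} [AddCommGroup W] [Module k W] [FiniteDimensional k W]

theorem isFiberSquare_prodKV (A' : ArtAlg Λ k) (V : Type u) [AddCommGroup V] [Module k V]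
    [FiniteDimensional k V] : IsFiberSquare (p₁ A' V) (p₂ A' V) (A := ArtAlg.base Λ k)
      A'.π (ArtAlg.kv k V Λ).π :=
  isFiberSquare_fiberProd (A := ArtAlg.base Λ k) _ _ (ArtAlg.kv k V Λ).π_surjective

theorem σ_apply (E : SmallExtension f V) (z : prodKV A' V) :
    E.σ z = p₁ A' V z + E.ι (ArtAlg.SqZero.im (p₂ A' V z)) := rfl

theorem map_ι (E : SmallExtension f V) (v : V) : f (E.ι v) = 0 := (E.ker_eq _).2 ⟨v, rfl⟩

theorem comp_σ (E : SmallExtension f V) : f.comp (p₁ A' V) = f.comp E.σ :=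
  AlgHom.ext fun z => by
    change f (p₁ A' V z) = f (E.σ z)
    rw [σ_apply, map_add, map_ι, add_zero]

/-- The ring isomorphism that carries the theorem: `A' ×_k k[V]` is also `A' ×_A A'`. The
`V`-component is the difference of the two coordinates, read through `E.ι`, and the `k`-component is
forced to be the residue of the first coordinate. -/
theorem isFiberSquare_σ (E : SmallExtension f V) : IsFiberSquare (p₁ A' V) E.σ f f where
  comm := E.comp_σ
  surj := E.surj
  injective z z' h h' := by
    rw [σ_apply, σ_apply, h] at h'
    have him := E.ι_injective (add_left_cancel h')
    refine (isFiberSquare_prodKV A' V).injective z z' h (ArtAlg.SqZero.ext ?_ him)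
    have hz : A'.π (p₁ A' V z) = ArtAlg.SqZero.re (p₂ A' V z) := z.2
    have hz' : A'.π (p₁ A' V z') = ArtAlg.SqZero.re (p₂ A' V z') := z'.2
    rw [← hz, ← hz', h]
  exists_eq x y h := by
    obtain ⟨v, hv⟩ := (E.ker_eq (y - x)).1 (by rw [map_sub, h, sub_self])
    refine ⟨⟨(x, ArtAlg.SqZero.mk (A'.π x) v), rfl⟩, rfl, ?_⟩
    change x + E.ι v = y
    rw [hv, add_sub_cancel]

theorem p₁_comp_incl : (p₁ A' V).comp (incl A' V) = AlgHom.id Λ A' := rfl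

theorem p₂_comp_incl : (p₂ A' V).comp (incl A' V) = (ArtAlg.kvIncl k V Λ).comp A'.π := rfl

theorem σ_comp_incl (E : SmallExtension f V) : E.σ.comp (incl A' V) = AlgHom.id Λ A' :=
  AlgHom.ext fun x => by
    change x + E.ι 0 = x
    rw [map_zero, add_zero]

/-- The map to `A' ×_k k[V]` with given components. -/
noncomputable def prodLift (a : C →ₐ[Λ] A') (b : C →ₐ[Λ] ArtAlg.kv k V Λ) :
    C →ₐ[Λ] prodKV A' V :=
  ArtAlg.lift (A := ArtAlg.base Λ k) A'.π (ArtAlg.kv k V Λ).π a b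
    (AlgHom.ext fun x => (ArtAlg.π_comp a x).trans (ArtAlg.π_comp b x).symm)

theorem prod_hom_ext {c d : C →ₐ[Λ] prodKV A' V} (h₁ : (p₁ A' V).comp c = (p₁ A' V).comp d)
    (h₂ : (p₂ A' V).comp c = (p₂ A' V).comp d) : c = d :=
  AlgHom.ext fun x => (isFiberSquare_prodKV A' V).injective _ _ (DFunLike.congr_fun h₁ x)
    (DFunLike.congr_fun h₂ x)

/-- The map `A' ×_k k[V] → B' ×_k k[W]` induced by `A' → B'` and `V → W`. -/
noncomputable def prodMap (g : A' →ₐ[Λ] B') (h : V →ₗ[k] W) : prodKV A' V →ₐ[Λ] prodKV B' W :=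
  prodLift (g.comp (p₁ A' V)) ((ArtAlg.kvMap Λ h).comp (p₂ A' V))

theorem prodMap_comp_incl (g : A' →ₐ[Λ] B') (h : V →ₗ[k] W) :
    (prodMap g h).comp (incl A' V) = (incl B' W).comp g :=
  prod_hom_ext rfl (AlgHom.ext fun x => ArtAlg.SqZero.ext (ArtAlg.π_comp g x).symm (map_zero h))

/-- The ring identity behind the functoriality of both actions. -/
theorem σ_comp_prodMap (E : SmallExtension f V) (E₂ : SmallExtension f₂ W) {g : A' →ₐ[Λ] B'}
    {h : V →ₗ[k] W} (hg : ∀ v, g (E.ι v) = E₂.ι (h v)) :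
    E₂.σ.comp (prodMap g h) = g.comp E.σ :=
  AlgHom.ext fun z => by
    change g (p₁ A' V z) + E₂.ι (h (ArtAlg.SqZero.im (p₂ A' V z))) = g (E.σ z)
    rw [σ_apply, map_add, hg]

/-- The map exchanging the factors of `k[V] ×_k k[V]`. -/
noncomputable def swap (Λ k : Type u) [CommRing Λ] [Field k] [Algebra Λ k] [CompleteLocalBase Λ k] (V : Type u)
    [AddCommGroup V] [Module k V] [FiniteDimensional k V] :
    prodKV (ArtAlg.kv k V Λ) V →ₐ[Λ] prodKV (ArtAlg.kv k V Λ) V :=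
  prodLift (p₂ (ArtAlg.kv k V Λ) V) (p₁ (ArtAlg.kv k V Λ) V)

/-- The ring identity behind commutativity of `T_V`. The `k`-coordinates match because the two
entries of `z` have the same residue. -/
theorem σ_triv_comp_swap : (triv Λ V).σ.comp (swap Λ k V) = (triv Λ V).σ :=
  AlgHom.ext fun z => by
    have hz : ArtAlg.SqZero.re (p₁ (ArtAlg.kv k V Λ) V z) =
      ArtAlg.SqZero.re (p₂ (ArtAlg.kv k V Λ) V z) := z.2
    refine ArtAlg.SqZero.ext ?_ ?_
    · change ArtAlg.SqZero.re (p₂ (ArtAlg.kv k V Λ) V z) + 0 =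
        ArtAlg.SqZero.re (p₁ (ArtAlg.kv k V Λ) V z) + 0
      rw [hz]
    · change ArtAlg.SqZero.im (p₂ (ArtAlg.kv k V Λ) V z) +
        ArtAlg.SqZero.im (p₁ (ArtAlg.kv k V Λ) V z) = ArtAlg.SqZero.im (p₁ (ArtAlg.kv k V Λ) V z) +
          ArtAlg.SqZero.im (p₂ (ArtAlg.kv k V Λ) V z)
      rw [add_comm]

/-- On triples `(x, v, w)`, both ways of forming `x + v + w` agree. -/
theorem σ_assoc (E : SmallExtension f V) :
    E.σ.comp (prodLift ((p₁ A' V).comp (p₁ (prodKV A' V) V)) ((triv Λ V).σ.comp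
      (prodLift ((p₂ A' V).comp (p₁ (prodKV A' V) V)) (p₂ (prodKV A' V) V)))) =
    E.σ.comp (prodLift (E.σ.comp (p₁ (prodKV A' V) V)) (p₂ (prodKV A' V) V)) :=
  AlgHom.ext fun z => by
    change p₁ A' V (p₁ (prodKV A' V) V z) + E.ι (ArtAlg.SqZero.im (p₂ A' V (p₁ (prodKV A' V) V z)) +
      ArtAlg.SqZero.im (p₂ (prodKV A' V) V z)) = p₁ A' V (p₁ (prodKV A' V) V z) +
      E.ι (ArtAlg.SqZero.im (p₂ A' V (p₁ (prodKV A' V) V z))) +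
      E.ι (ArtAlg.SqZero.im (p₂ (prodKV A' V) V z))
    rw [map_add, add_assoc]

theorem π_comp_hom (g : A' →ₐ[Λ] B') : B'.π.comp g = A'.π :=
  AlgHom.ext (ArtAlg.π_comp g)

theorem kvMap_comp_kvIncl (h : V →ₗ[k] W) :
    (ArtAlg.kvMap Λ h).comp (ArtAlg.kvIncl k V Λ) = ArtAlg.kvIncl k W Λ :=
  AlgHom.ext fun _ => ArtAlg.SqZero.ext rfl (map_zero h)

end SmallExtension

end rings

/-! ### Existence of addition laws -/

section additionLaw

variable {Λ k : Type u} [CommRing Λ] [Field k] [Algebra Λ k] [CompleteLocalBase Λ k]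
  {S : Type u₂} [Category.{v₂} S] {p : S ⥤ (ArtAlg Λ k)ᵒᵖ}
  {A' A : ArtAlg Λ k} {f : A' →ₐ[Λ] A}
  {V : Type u} [AddCommGroup V] [Module k V] [FiniteDimensional k V]

open SmallExtension

/-- The pushforward `ω` of `η` under `A' → A' ×_k k[V]`, with its restrictions to `A'`, `k[V]`, and
its pushforward under `σ`, the canonical ones. -/
structure ZeroStar (ζ : TrivialObjects p) (E : SmallExtension f V) (η : Fib p A') where
  ω : Fib p (prodKV A' V)
  c : HomOver p (incl A' V) ω η
  z : HomOver p (A := ArtAlg.base Λ k) A'.π ζ.ζ₀ η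
  q₁ : HomOver p (p₁ A' V) η ω
  q₂ : HomOver p (p₂ A' V) (ζ.ζ V) ω
  s : HomOver p E.σ η ω
  q₁_c : q₁.1 ≫ c.1 = 𝟙 η.1
  q₂_c : q₂.1 ≫ c.1 = (ζ.toζ₀ V).1 ≫ z.1
  s_c : s.1 ≫ c.1 = 𝟙 η.1

/-- Both `p₁` and `σ` are retractions of `incl`, while `p₂` after `incl` factors through `k`. So the
three restrictions of the pushforward of `η` under `incl` are `η`, `ζ_V` and `η`, with explicit
maps. -/
theorem IsDeformationStack.nonempty_zeroStar (hp : IsDeformationStack p) (ζ : TrivialObjects p)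
    (E : SmallExtension f V) (η : Fib p A') : Nonempty (ZeroStar ζ E η) := by
  obtain ⟨ω, ⟨c⟩⟩ := hp.fibered.exists_pushforward (incl A' V) η
  obtain ⟨z⟩ := hp.exists_toBase ζ.ζ₀ A'.π η
  obtain ⟨q₁, h₁⟩ := hp.fibered.exists_factor c (HomOver.ofFiber (𝟙 η)) p₁_comp_incl
  obtain ⟨q₂, h₂⟩ := hp.fibered.exists_factor c ((ζ.toζ₀ V).comp z rfl) p₂_comp_incl
  obtain ⟨s, h₃⟩ := hp.fibered.exists_factor c (HomOver.ofFiber (𝟙 η)) E.σ_comp_incl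
  exact ⟨⟨ω, c, z, q₁, q₂, s, h₁, h₂, h₃⟩⟩

theorem IsDeformationStack.nonempty_additionLaw (hp : IsDeformationStack p) (ζ : TrivialObjects p)
    (E : SmallExtension f V) : Nonempty (AdditionLaw ζ E) := by
  have sq := isFiberSquare_prodKV A' V
  choose star q₁ q₂ using fun (η₁ : Fib p A') (η₂ : Fib p (ArtAlg.kv k V Λ)) =>
    hp.exists_star sq η₁ η₂
  let q₁ := fun η₁ η₂ => (q₁ η₁ η₂).some
  let q₂ := fun η₁ η₂ => (q₂ η₁ η₂).some
  choose add push using fun (η₁ : Fib p A') (η₂ : Fib p (ArtAlg.kv k V Λ)) =>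
    hp.fibered.exists_pushforward E.σ (star η₁ η₂)
  let push := fun η₁ η₂ => (push η₁ η₂).some
  have hstar : ∀ {η₁ θ₁ : Fib p A'} {η₂ θ₂ : Fib p (ArtAlg.kv k V Λ)} (f₁ : η₁ ⟶ θ₁)
      (f₂ : η₂ ⟶ θ₂), ∃! h : star η₁ η₂ ⟶ star θ₁ θ₂,
        (q₁ η₁ η₂).1 ≫ h.1 = f₁.1 ≫ (q₁ θ₁ θ₂).1 ∧ (q₂ η₁ η₂).1 ≫ h.1 = f₂.1 ≫ (q₂ θ₁ θ₂).1 :=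
    fun f₁ f₂ => hp.existsUnique_starHom sq _ _ _ _ f₁ f₂
  choose starHom hstarHom huniq using @hstar
  choose addHom haddHom using fun {η₁ θ₁ : Fib p A'} {η₂ θ₂ : Fib p (ArtAlg.kv k V Λ)}
    (f₁ : η₁ ⟶ θ₁) (f₂ : η₂ ⟶ θ₂) =>
    hp.fibered.exists_fiber_factor (push θ₁ θ₂) ((push η₁ η₂).postcomp (starHom f₁ f₂))
  have haddHom' : ∀ {η₁ θ₁ : Fib p A'} {η₂ θ₂ : Fib p (ArtAlg.kv k V Λ)}
    (f₁ : η₁ ⟶ θ₁) (f₂ : η₂ ⟶ θ₂),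
    (addHom f₁ f₂).1 ≫ (push θ₁ θ₂).1 = (push η₁ η₂).1 ≫ (starHom f₁ f₂).1 := haddHom
  -- The chosen `η * ζ_V` is compared with the pushforward of `η` under `incl` by gluing identities.
  -- Composing with `push` gives a map over `σ ∘ incl = id`, hence a morphism of the fiber.
  have hunit : ∀ η, ∃ (u : add η (ζ.ζ V) ⟶ η)
      (z : HomOver p (A := ArtAlg.base Λ k) A'.π ζ.ζ₀ η)
      (c : HomOver p (incl A' V) (star η (ζ.ζ V)) η),
      (q₁ η (ζ.ζ V)).1 ≫ c.1 = 𝟙 η.1 ∧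
      (q₂ η (ζ.ζ V)).1 ≫ c.1 = (ζ.toζ₀ V).1 ≫ z.1 ∧
      u.1 = (push η (ζ.ζ V)).1 ≫ c.1 := by
    intro η
    obtain ⟨Z⟩ := hp.nonempty_zeroStar ζ E η
    obtain ⟨j, ⟨h₁, h₂⟩, -⟩ := hp.existsUnique_starHom sq (q₁ η (ζ.ζ V)) (q₂ η (ζ.ζ V)) Z.q₁ Z.q₂
      (𝟙 _) (𝟙 _)
    rw [fib_id_val, Category.id_comp] at h₁ h₂
    refine ⟨((push η (ζ.ζ V)).comp (Z.c.precomp j) E.σ_comp_incl).toFiber rfl, Z.z,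
      Z.c.precomp j, ?_, ?_, rfl⟩
    · change _ ≫ j.1 ≫ Z.c.1 = _
      rw [reassoc_of% h₁, Z.q₁_c]
    · change _ ≫ j.1 ≫ Z.c.1 = _
      rw [reassoc_of% h₂, Z.q₂_c]
  choose unit hunit using hunit
  refine ⟨{
    functor :=
      { obj := fun X => add X.1 X.2
        map := fun F => addHom F.1 F.2
        map_id := fun X => hp.fibered.fiber_cancel (push _ _) _ _ ?_
        map_comp := fun {X Y Z} F G => hp.fibered.fiber_cancel (push _ _) _ _ ?_ }
    star := star
    q₁ := q₁
    q₂ := q₂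
    push := push
    map_spec := fun f₁ f₂ => ⟨starHom f₁ f₂, (hstarHom f₁ f₂).1, (hstarHom f₁ f₂).2,
      haddHom f₁ f₂⟩
    unit := unit
    unit_spec := hunit }⟩
  -- Functoriality of the sum follows from uniqueness of the glued morphism on `η₁ * η₂`,
  -- transferred through the cartesian map `push`.
  · have h : 𝟙 (star X.1 X.2) = starHom (𝟙 X.1) (𝟙 X.2) :=
      huniq (𝟙 X.1) (𝟙 X.2) (𝟙 _)
        ⟨(Category.comp_id _).trans (Category.id_comp _).symm,
          (Category.comp_id _).trans (Category.id_comp _).symm⟩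
    refine (haddHom' (𝟙 X.1) (𝟙 X.2)).trans ?_
    rw [← h]
    exact (Category.comp_id _).trans (Category.id_comp _).symm
  · have h : starHom F.1 F.2 ≫ starHom G.1 G.2 = starHom (F.1 ≫ G.1) (F.2 ≫ G.2) := by
      refine huniq (F.1 ≫ G.1) (F.2 ≫ G.2) (starHom F.1 F.2 ≫ starHom G.1 G.2) ⟨?_, ?_⟩
      · rw [fib_comp_val, fib_comp_val, reassoc_of% (hstarHom F.1 F.2).1, (hstarHom G.1 G.2).1,
          Category.assoc]
      · rw [fib_comp_val, fib_comp_val, reassoc_of% (hstarHom F.1 F.2).2, (hstarHom G.1 G.2).2,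
          Category.assoc]
    refine (haddHom' (F.1 ≫ G.1) (F.2 ≫ G.2)).trans ?_
    rw [← h, fib_comp_val, fib_comp_val, Category.assoc, haddHom',
      reassoc_of% (haddHom' F.1 F.2)]

end additionLaw

/-! ### The relation "`y` is the sum of `x` and a tangent vector" -/

section sums

variable {Λ k : Type u} [CommRing Λ] [Field k] [Algebra Λ k] [CompleteLocalBase Λ k]
  {S : Type u₂} [Category.{v₂} S] {p : S ⥤ (ArtAlg Λ k)ᵒᵖ}
  {A' A B' B : ArtAlg Λ k} {f : A' →ₐ[Λ] A} {f₂ : B' →ₐ[Λ] B}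
  {V : Type u} [AddCommGroup V] [Module k V] [FiniteDimensional k V]
  {W : Type u} [AddCommGroup W] [Module k W] [FiniteDimensional k W]

open SmallExtension

/-- `cancel` for two composites through different objects. It serves to check a compatibility in a
pushforward `ω` by computing in the object `ξ` where the maps are known. -/
theorem IsFiberedInGroupoids.comp_eq_comp (hS : IsFiberedInGroupoids p) {C D : ArtAlg Λ k}
    {c : C →ₐ[Λ] D} {a : D →ₐ[Λ] A'} {b : D →ₐ[Λ] B'} {g : A' →ₐ[Λ] A} {g' : B' →ₐ[Λ] A}
    {ξ : Fib p C} {ω : Fib p D} {η : Fib p A'} {η' : Fib p B'} {η₀ : Fib p A}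
    (n : HomOver p c ω ξ) (t : HomOver p a η ω) (t' : HomOver p b η' ω)
    (r : HomOver p g η₀ η) (r' : HomOver p g' η₀ η') (hg : g'.comp b = g.comp a)
    (h : r.1 ≫ t.1 ≫ n.1 = r'.1 ≫ t'.1 ≫ n.1) : r.1 ≫ t.1 = r'.1 ≫ t'.1 :=
  congrArg Subtype.val (hS.cancel n (r.comp t rfl) (r'.comp t' hg)
    (by
      change (r.1 ≫ t.1) ≫ n.1 = (r'.1 ≫ t'.1) ≫ n.1
      rw [Category.assoc, Category.assoc, h]))

/-- A morphism out of an object glued along a fiber square over the residue field is determined by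
its components. -/
theorem IsDeformationStack.existsUnique_starHomOver (hp : IsDeformationStack p)
    {C D A' A'' : ArtAlg Λ k} {a : C →ₐ[Λ] A'} {b : C →ₐ[Λ] A''}
    {f : A' →ₐ[Λ] ArtAlg.base Λ k} {g : A'' →ₐ[Λ] ArtAlg.base Λ k} (h : IsFiberSquare a b f g)
    {e : D →ₐ[Λ] C} {c : D →ₐ[Λ] A'} {d : D →ₐ[Λ] A''}
    {ω : Fib p C} {η₁ : Fib p A'} {η₂ : Fib p A''} {ξ : Fib p D}
    (a₁ : HomOver p a η₁ ω) (a₂ : HomOver p b η₂ ω) (t₁ : HomOver p c η₁ ξ)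
    (t₂ : HomOver p d η₂ ξ) (hc : a.comp e = c) (hd : b.comp e = d) :
    ∃! m : HomOver p e ω ξ, a₁.1 ≫ m.1 = t₁.1 ∧ a₂.1 ≫ m.1 = t₂.1 := by
  have hS := hp.fibered
  obtain ⟨ω', ⟨n⟩⟩ := hS.exists_pushforward e ξ
  obtain ⟨b₁, h₁⟩ := hS.exists_factor n t₁ hc
  obtain ⟨b₂, h₂⟩ := hS.exists_factor n t₂ hd
  obtain ⟨j, ⟨hj₁, hj₂⟩, hj⟩ := hp.existsUnique_starHom h a₁ a₂ b₁ b₂ (𝟙 _) (𝟙 _)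
  simp only [fib_id_val, Category.id_comp] at hj₁ hj₂ hj
  refine ⟨n.precomp j, ⟨?_, ?_⟩, fun m ⟨hm₁, hm₂⟩ => ?_⟩
  · change a₁.1 ≫ j.1 ≫ n.1 = _
    rw [reassoc_of% hj₁, h₁]
  · change a₂.1 ≫ j.1 ≫ n.1 = _
    rw [reassoc_of% hj₂, h₂]
  · obtain ⟨j', hj'⟩ := hS.exists_fiber_factor n m
    have : j' = j := by
      refine hj j' ⟨?_, ?_⟩
      · refine congrArg Subtype.val (hS.cancel n (a₁.postcomp j') b₁ ?_)
        change (a₁.1 ≫ j'.1) ≫ n.1 = _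
        rw [Category.assoc, hj', hm₁, h₁]
      · refine congrArg Subtype.val (hS.cancel n (a₂.postcomp j') b₂ ?_)
        change (a₂.1 ≫ j'.1) ≫ n.1 = _
        rw [Category.assoc, hj', hm₂, h₂]
    exact Subtype.ext (by rw [← hj', this]; rfl)

/-- The lift `y` is a sum of the lift `x` and the object `η₂` over `k[V]`. -/
def IsSum (E : SmallExtension f V) {η : Fib p A} (x y : LiftPair E η)
    (η₂ : Fib p (ArtAlg.kv k V Λ)) : Prop :=
  ∃ (ω : Fib p (prodKV A' V)) (q₁ : HomOver p (p₁ A' V) x.obj ω) (_ : HomOver p (p₂ A' V) η₂ ω)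
    (s : HomOver p E.σ y.obj ω), x.map.1 ≫ q₁.1 = y.map.1 ≫ s.1

namespace IsSum

variable {E : SmallExtension f V} {η : Fib p A} (hp : IsDeformationStack p)
include hp

theorem exists_sum (x : LiftPair E η) (η₂ : Fib p (ArtAlg.kv k V Λ)) : ∃ y, IsSum E x y η₂ := by
  obtain ⟨ω, ⟨q₁⟩, ⟨q₂⟩⟩ := hp.exists_star (isFiberSquare_prodKV A' V) x.obj η₂
  obtain ⟨y, ⟨s⟩⟩ := hp.fibered.exists_pushforward E.σ ω
  obtain ⟨χ, hχ⟩ := hp.fibered.exists_factor s (x.map.comp q₁ rfl) E.comp_σ.symm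
  exact ⟨⟨y, χ⟩, ω, q₁, q₂, s, hχ.symm⟩

/-- The second reading of `A' ×_k k[V]`: the two lifts glue along the square of `p₁` and `σ`, and
the restriction of the result along `p₂` is their difference. -/
theorem exists_difference (x y : LiftPair E η) : ∃ η₂, IsSum E x y η₂ := by
  obtain ⟨ω, q₁, s, h⟩ := E.isFiberSquare_σ.exists_glue hp x.map y.map
  obtain ⟨η₂, ⟨q₂⟩⟩ := hp.fibered.exists_pushforward (p₂ A' V) ω
  exact ⟨η₂, ω, q₁, q₂, s, h⟩

/-- Addition is well defined on classes: isomorphisms of the summands glue over `k`, and the glued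
morphism restricts along `σ`. -/
theorem equiv_of_iso {x y x' y' : LiftPair E η} {η₂ η₂' : Fib p (ArtAlg.kv k V Λ)}
    (h : IsSum E x y η₂) (h' : IsSum E x' y' η₂') (hx : x ≈ x') (χ : η₂ ⟶ η₂') : y ≈ y' := by
  obtain ⟨ω, q₁, q₂, s, e⟩ := h
  obtain ⟨ω', q₁', q₂', s', e'⟩ := h'
  obtain ⟨ψ, hψ⟩ := hx
  obtain ⟨j, ⟨hj₁, hj₂⟩, -⟩ :=
    hp.existsUnique_starHom (isFiberSquare_prodKV A' V) q₁ q₂ q₁' q₂' ψ.hom χ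
  obtain ⟨u, hu⟩ := hp.fibered.exists_fiber_factor s' (s.postcomp j)
  replace hu : u.1 ≫ s'.1 = s.1 ≫ j.1 := hu
  refine ⟨hp.fibered.isoOfHom u, congrArg Subtype.val
    (hp.fibered.cancel s' (y.map.postcomp u) y'.map ?_)⟩
  change (y.map.1 ≫ u.1) ≫ s'.1 = y'.map.1 ≫ s'.1
  rw [Category.assoc, hu, ← e', ← reassoc_of% e, hj₁, reassoc_of% hψ]

/-- Subtraction is well defined on classes: isomorphisms of the two lifts glue over `A`, since both
restrict to the identity of `η`, and the glued morphism restricts along `p₂`. -/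
theorem nonempty_hom_of_equiv {x y x' y' : LiftPair E η} {η₂ η₂' : Fib p (ArtAlg.kv k V Λ)}
    (h : IsSum E x y η₂) (h' : IsSum E x' y' η₂') (hx : x ≈ x') (hy : y ≈ y') :
    Nonempty (η₂ ⟶ η₂') := by
  obtain ⟨ω, q₁, q₂, s, e⟩ := h
  obtain ⟨ω', q₁', q₂', s', e'⟩ := h'
  obtain ⟨ψ, hψ⟩ := hx
  obtain ⟨χ, hχ⟩ := hy
  obtain ⟨j, -, -⟩ := E.isFiberSquare_σ.existsUnique_hom hp q₁ s x.map y.map q₁' s' x'.map y'.map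
    e e' ψ.hom χ.hom (𝟙 _) (by rw [hψ, fib_id_val, Category.id_comp])
    (by rw [hχ, fib_id_val, Category.id_comp])
  obtain ⟨u, -⟩ := hp.fibered.exists_fiber_factor q₂' (q₂.postcomp j)
  exact ⟨u⟩

theorem zero (ζ : TrivialObjects p) (x : LiftPair E η) : IsSum E x x (ζ.ζ V) := by
  obtain ⟨Z⟩ := hp.nonempty_zeroStar ζ E x.obj
  refine ⟨Z.ω, Z.q₁, Z.q₂, Z.s, hp.fibered.comp_eq_comp Z.c Z.q₁ Z.s x.map x.map
    E.comp_σ.symm ?_⟩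
  rw [Z.q₁_c, Z.s_c]

/-- An object `ω` witnessing a sum is pushed forward under `prodMap g h`. Its three restrictions are
the pushforwards of the original ones because `p₁`, `p₂` and `σ` all commute with `prodMap`. -/
theorem map {E₂ : SmallExtension f₂ W} {ηB : Fib p B} {g : A' →ₐ[Λ] B'} {gbar : A →ₐ[Λ] B}
    {h : V →ₗ[k] W} (hι : ∀ v, g (E.ι v) = E₂.ι (h v))
    (t : HomOver p gbar ηB η) {x y : LiftPair E η} {x' y' : LiftPair E₂ ηB}
    (tx : HomOver p g x'.obj x.obj) (ty : HomOver p g y'.obj y.obj)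
    (hx : x'.map.1 ≫ tx.1 = t.1 ≫ x.map.1) (hy : y'.map.1 ≫ ty.1 = t.1 ≫ y.map.1)
    {η₂ : Fib p (ArtAlg.kv k V Λ)} {θ₂ : Fib p (ArtAlg.kv k W Λ)}
    (m : HomOver p (ArtAlg.kvMap Λ h) θ₂ η₂) (hs : IsSum E x y η₂) : IsSum E₂ x' y' θ₂ := by
  obtain ⟨ω, q₁, q₂, s, e⟩ := hs
  obtain ⟨ω', ⟨n⟩⟩ := hp.fibered.exists_pushforward (prodMap g h) ω
  obtain ⟨u₁, h₁⟩ := hp.fibered.exists_factor n (tx.comp q₁ rfl) (g := p₁ B' W) rfl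
  obtain ⟨u₂, h₂⟩ := hp.fibered.exists_factor n (m.comp q₂ rfl) (g := p₂ B' W) rfl
  obtain ⟨u₃, h₃⟩ := hp.fibered.exists_factor n (ty.comp s rfl) (g := E₂.σ)
    (σ_comp_prodMap E E₂ hι)
  refine ⟨ω', u₁, u₂, u₃, hp.fibered.comp_eq_comp n u₁ u₃ x'.map y'.map
    E₂.comp_σ.symm ?_⟩
  replace h₁ : u₁.1 ≫ n.1 = tx.1 ≫ q₁.1 := h₁
  replace h₃ : u₃.1 ≫ n.1 = ty.1 ≫ s.1 := h₃
  rw [h₁, h₃, reassoc_of% hx, reassoc_of% hy, e]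

/-- Pushing the witness forward under `swap` exchanges the summands and keeps the sum. -/
theorem comm {ζ₀ : Fib p (ArtAlg.base Λ k)} {x y x' : LiftPair (triv Λ V) ζ₀}
    (h : IsSum (triv Λ V) x y x'.obj) : IsSum (triv Λ V) x' y x.obj := by
  obtain ⟨ω, q₁, q₂, s, e⟩ := h
  obtain ⟨ω', ⟨n⟩⟩ := hp.fibered.exists_pushforward (swap Λ k V) ω
  obtain ⟨u₁, h₁⟩ := hp.fibered.exists_factor n q₂ (g := p₁ (ArtAlg.kv k V Λ) V) rfl
  obtain ⟨u₂, h₂⟩ := hp.fibered.exists_factor n q₁ (g := p₂ (ArtAlg.kv k V Λ) V) rfl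
  obtain ⟨u₃, h₃⟩ := hp.fibered.exists_factor n s σ_triv_comp_swap
  exact ⟨ω', u₁, u₂, u₃, congrArg Subtype.val (hp.toBase_unique (x'.map.comp u₁ rfl)
    (y.map.comp u₃ (triv Λ V).comp_σ.symm))⟩

theorem assoc {ζ₀ : Fib p (ArtAlg.base Λ k)} {x y z : LiftPair E η}
    {η₃ : Fib p (ArtAlg.kv k V Λ)} {x₂ x₄ : LiftPair (triv Λ V) ζ₀} (h : IsSum E x y x₂.obj)
    (h' : IsSum E y z η₃) (h'' : IsSum (triv Λ V) x₂ x₄ η₃) : IsSum E x z x₄.obj := by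
  have hS := hp.fibered
  obtain ⟨ω₁, q₁, q₂, s, e⟩ := h
  obtain ⟨ω₂, q₁', q₂', s', e'⟩ := h'
  obtain ⟨ω₃, q₁'', q₂'', s'', -⟩ := h''
  -- `Ω` lives over triples `(x, v, w)`. The witnesses of the other two given sums are restrictions
  -- of it, through `M₂` along `(x + v, w)` and `M₃` along `(v, w)`; the witness `ω₄` of the
  -- required sum is its restriction along `(x, v + w)`.
  obtain ⟨Ω, ⟨P⟩, ⟨Q⟩⟩ := hp.exists_star (isFiberSquare_prodKV (prodKV A' V) V) ω₁ η₃
  obtain ⟨M₂, ⟨hM₂, -⟩, -⟩ := hp.existsUnique_starHomOver (isFiberSquare_prodKV A' V)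
    (e := prodLift (E.σ.comp (p₁ (prodKV A' V) V)) (p₂ (prodKV A' V) V)) q₁' q₂'
    (s.comp P rfl) Q rfl rfl
  obtain ⟨M₃, -, -⟩ := hp.existsUnique_starHomOver (isFiberSquare_prodKV (ArtAlg.kv k V Λ) V)
    (e := prodLift ((p₂ A' V).comp (p₁ (prodKV A' V) V)) (p₂ (prodKV A' V) V)) q₁'' q₂''
    (q₂.comp P rfl) Q rfl rfl
  obtain ⟨ω₄, ⟨n⟩⟩ := hS.exists_pushforward
    (prodLift ((p₁ A' V).comp (p₁ (prodKV A' V) V)) ((triv Λ V).σ.comp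
      (prodLift ((p₂ A' V).comp (p₁ (prodKV A' V) V)) (p₂ (prodKV A' V) V)))) Ω
  obtain ⟨u₁, h₁⟩ := hS.exists_factor n (q₁.comp P rfl) (g := p₁ A' V) rfl
  obtain ⟨u₂, h₂⟩ := hS.exists_factor n (s''.comp M₃ rfl) (g := p₂ A' V) rfl
  obtain ⟨u₃, h₃⟩ := hS.exists_factor n (s'.comp M₂ rfl) E.σ_assoc
  refine ⟨ω₄, u₁, u₂, u₃, hS.comp_eq_comp n u₁ u₃ x.map z.map E.comp_σ.symm ?_⟩
  replace h₁ : u₁.1 ≫ n.1 = q₁.1 ≫ P.1 := h₁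
  replace h₃ : u₃.1 ≫ n.1 = s'.1 ≫ M₂.1 := h₃
  replace hM₂ : q₁'.1 ≫ M₂.1 = s.1 ≫ P.1 := hM₂
  rw [h₁, h₃, reassoc_of% e, ← reassoc_of% e', hM₂]

end IsSum

end sums

/-! ### The group `T_V` and its action on lifts -/

section tangent

variable {Λ k : Type u} [CommRing Λ] [Field k] [Algebra Λ k] [CompleteLocalBase Λ k]
  {S : Type u₂} [Category.{v₂} S] {p : S ⥤ (ArtAlg Λ k)ᵒᵖ}
  {A' A B' B : ArtAlg Λ k} {f : A' →ₐ[Λ] A} {f₂ : B' →ₐ[Λ] B}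
  {U : Type u} [AddCommGroup U] [Module k U] [FiniteDimensional k U]
  {V : Type u} [AddCommGroup V] [Module k V] [FiniteDimensional k V]
  {W : Type u} [AddCommGroup W] [Module k W] [FiniteDimensional k W]

open SmallExtension

theorem Lifts.mk_eq_mk {E : SmallExtension f V} {η : Fib p A} {x y : LiftPair E η} :
    Lifts.mk x = Lifts.mk y ↔ x ≈ y := Quotient.eq

theorem Lifts.exists_mk {E : SmallExtension f V} {η : Fib p A} (X : Lifts E η) :
    ∃ x, Lifts.mk x = X := Quotient.exists_rep X

theorem TangentSet.mk_eq_mk {η θ : Fib p (ArtAlg.kv k V Λ)} :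
    TangentSet.mk η = TangentSet.mk θ ↔ Nonempty (η ≅ θ) := Quotient.eq

theorem TangentSet.exists_mk (τ : TangentSet p V) : ∃ η, TangentSet.mk η = τ :=
  Quotient.exists_rep τ

theorem AdditionLaw.isSum {ζ : TrivialObjects p} {E : SmallExtension f V} (L : AdditionLaw ζ E)
    {η : Fib p A} (x : LiftPair E η) (η₂ : Fib p (ArtAlg.kv k V Λ))
    (χ : HomOver p f η (L.add x.obj η₂))
    (hχ : x.map.1 ≫ (L.q₁ x.obj η₂).1 = χ.1 ≫ (L.push x.obj η₂).1) :
    IsSum E x ⟨L.add x.obj η₂, χ⟩ η₂ :=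
  ⟨L.star x.obj η₂, L.q₁ x.obj η₂, L.q₂ x.obj η₂, L.push x.obj η₂, hχ⟩

namespace IsDeformationStack

variable (hp : IsDeformationStack p) (ζ : TrivialObjects p)

/-- An object over `k[V]`, as a lift of the object over `k`. -/
noncomputable def trivLift (η : Fib p (ArtAlg.kv k V Λ)) : LiftPair (triv Λ V) ζ.ζ₀ :=
  ⟨η, (hp.exists_toBase ζ.ζ₀ (ArtAlg.kv k V Λ).π η).some⟩

include hp in
-- `T_V` is the set of lifts of `ζ₀` along `k[V] → k`, since the map from `ζ₀` carries no
-- information. Hence addition on `T_V` is a case of the action on lifts.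
theorem mk_eq_mk_iff_of_base {x y : LiftPair (triv Λ V) ζ.ζ₀} :
    Lifts.mk x = Lifts.mk y ↔ TangentSet.mk x.obj = TangentSet.mk y.obj := by
  refine Lifts.mk_eq_mk.trans (Iff.trans ?_ TangentSet.mk_eq_mk.symm)
  constructor
  · rintro ⟨ψ, -⟩
    exact ⟨ψ⟩
  · rintro ⟨ψ⟩
    exact ⟨ψ, congrArg Subtype.val (hp.toBase_unique (x.map.postcomp ψ.hom) y.map)⟩

include hp in
-- The value is characterized on all representatives and all sums at once, so the operation chosen
-- from it can be evaluated on any sum that is at hand.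
theorem exists_lifts_vadd {E : SmallExtension f V} {η : Fib p A} (τ : TangentSet p V)
    (X : Lifts E η) : ∃ Y : Lifts E η, ∀ x η₂ y, TangentSet.mk η₂ = τ → Lifts.mk x = X →
      IsSum E x y η₂ → Y = Lifts.mk y := by
  obtain ⟨η₂, rfl⟩ := τ.exists_mk
  obtain ⟨x, rfl⟩ := X.exists_mk
  obtain ⟨y, hy⟩ := IsSum.exists_sum hp x η₂
  refine ⟨Lifts.mk y, fun x' η₂' y' hη hx h => ?_⟩
  obtain ⟨χ⟩ := TangentSet.mk_eq_mk.1 hη.symm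
  exact Lifts.mk_eq_mk.2 (IsSum.equiv_of_iso hp hy h (Lifts.mk_eq_mk.1 hx.symm) χ.hom)

/-- The action of `T_V` on `T_{η, A'}`. -/
@[reducible] noncomputable def liftsVAdd (E : SmallExtension f V) (η : Fib p A) :
    VAdd (TangentSet p V) (Lifts E η) :=
  ⟨fun τ X => (hp.exists_lifts_vadd τ X).choose⟩

theorem liftsVAdd_eq {E : SmallExtension f V} {η : Fib p A} {x y : LiftPair E η}
    {η₂ : Fib p (ArtAlg.kv k V Λ)} (h : IsSum E x y η₂) :
    (hp.liftsVAdd E η).vadd (TangentSet.mk η₂) (Lifts.mk x) = Lifts.mk y :=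
  (hp.exists_lifts_vadd (TangentSet.mk η₂) (Lifts.mk x)).choose_spec x η₂ y rfl rfl h

include hp in
theorem exists_tangent_add (τ₁ τ₂ : TangentSet p V) : ∃ τ : TangentSet p V,
    ∀ (x y : LiftPair (triv Λ V) ζ.ζ₀) (η₂ : Fib p (ArtAlg.kv k V Λ)), TangentSet.mk x.obj = τ₁ →
      TangentSet.mk η₂ = τ₂ → IsSum (triv Λ V) x y η₂ → τ = TangentSet.mk y.obj := by
  obtain ⟨η₁, rfl⟩ := τ₁.exists_mk
  obtain ⟨Y, hY⟩ := hp.exists_lifts_vadd τ₂ (Lifts.mk (hp.trivLift ζ η₁))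
  obtain ⟨y, rfl⟩ := Y.exists_mk
  refine ⟨TangentSet.mk y.obj, fun x' y' η₂' hx h₂ h => ?_⟩
  exact (hp.mk_eq_mk_iff_of_base ζ).1 (hY x' η₂' y' h₂ ((hp.mk_eq_mk_iff_of_base ζ).2 hx) h)

/-- The sum of two elements of `T_V`. -/
noncomputable def tangentAdd (τ₁ τ₂ : TangentSet p V) : TangentSet p V :=
  (hp.exists_tangent_add ζ τ₁ τ₂).choose

theorem tangentAdd_eq {x y : LiftPair (triv Λ V) ζ.ζ₀} {η₂ : Fib p (ArtAlg.kv k V Λ)}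
    (h : IsSum (triv Λ V) x y η₂) :
    hp.tangentAdd ζ (TangentSet.mk x.obj) (TangentSet.mk η₂) = TangentSet.mk y.obj :=
  (hp.exists_tangent_add ζ _ _).choose_spec x y η₂ rfl rfl h

/-- Representatives of two elements of `T_V` and of their sum. -/
theorem exists_tangent_sum (τ₁ τ₂ : TangentSet p V) :
    ∃ x y x₂ : LiftPair (triv Λ V) ζ.ζ₀, IsSum (triv Λ V) x y x₂.obj ∧
      TangentSet.mk x.obj = τ₁ ∧ TangentSet.mk x₂.obj = τ₂ ∧
        hp.tangentAdd ζ τ₁ τ₂ = TangentSet.mk y.obj := by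
  obtain ⟨η₁, rfl⟩ := τ₁.exists_mk
  obtain ⟨η₂, rfl⟩ := τ₂.exists_mk
  obtain ⟨y, hy⟩ := IsSum.exists_sum hp (hp.trivLift ζ η₁) η₂
  exact ⟨hp.trivLift ζ η₁, y, hp.trivLift ζ η₂, hy, rfl, rfl, hp.tangentAdd_eq ζ hy⟩

theorem tangentAdd_comm (τ₁ τ₂ : TangentSet p V) :
    hp.tangentAdd ζ τ₁ τ₂ = hp.tangentAdd ζ τ₂ τ₁ := by
  obtain ⟨x, y, x₂, h, rfl, rfl, e⟩ := hp.exists_tangent_sum ζ τ₁ τ₂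
  rw [e, hp.tangentAdd_eq ζ (IsSum.comm hp h)]

theorem tangentAdd_assoc (τ₁ τ₂ τ₃ : TangentSet p V) :
    hp.tangentAdd ζ (hp.tangentAdd ζ τ₁ τ₂) τ₃ = hp.tangentAdd ζ τ₁ (hp.tangentAdd ζ τ₂ τ₃) := by
  obtain ⟨x₁, y, x₂, h, rfl, rfl, e⟩ := hp.exists_tangent_sum ζ τ₁ τ₂
  obtain ⟨η₃, rfl⟩ := τ₃.exists_mk
  obtain ⟨z, h'⟩ := IsSum.exists_sum hp y η₃
  obtain ⟨w, h''⟩ := IsSum.exists_sum hp x₂ η₃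
  rw [e, hp.tangentAdd_eq ζ h', hp.tangentAdd_eq ζ h'',
    hp.tangentAdd_eq ζ (IsSum.assoc hp h h' h'')]

theorem tangentAdd_zero (τ : TangentSet p V) :
    hp.tangentAdd ζ τ (TangentSet.mk (ζ.ζ V)) = τ := by
  obtain ⟨η, rfl⟩ := τ.exists_mk
  exact hp.tangentAdd_eq ζ (IsSum.zero hp ζ (hp.trivLift ζ η))

theorem exists_tangent_neg (τ : TangentSet p V) :
    ∃ τ', hp.tangentAdd ζ τ' τ = TangentSet.mk (ζ.ζ V) := by
  obtain ⟨η, rfl⟩ := τ.exists_mk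
  -- The negative is the difference from the class itself to the zero class.
  obtain ⟨η₂, h⟩ := IsSum.exists_difference hp (hp.trivLift ζ η) (hp.trivLift ζ (ζ.ζ V))
  exact ⟨TangentSet.mk η₂, (hp.tangentAdd_comm ζ _ _).trans (hp.tangentAdd_eq ζ h)⟩

/-- The group structure of `T_V`. -/
@[reducible] noncomputable def tangentAddCommGroup (V : Type u) [AddCommGroup V] [Module k V]
    [FiniteDimensional k V] : AddCommGroup (TangentSet p V) :=
  letI : Add (TangentSet p V) := ⟨hp.tangentAdd ζ⟩
  letI : Zero (TangentSet p V) := ⟨TangentSet.mk (ζ.ζ V)⟩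
  letI : Neg (TangentSet p V) := ⟨fun τ => (hp.exists_tangent_neg ζ τ).choose⟩
  { AddGroup.ofLeftAxioms (hp.tangentAdd_assoc ζ)
      (fun τ => (hp.tangentAdd_comm ζ _ _).trans (hp.tangentAdd_zero ζ τ))
      (fun τ => (hp.exists_tangent_neg ζ τ).choose_spec) with
    add_comm := hp.tangentAdd_comm ζ }

theorem liftsVAdd_zero {E : SmallExtension f V} {η : Fib p A} (X : Lifts E η) :
    (hp.liftsVAdd E η).vadd (TangentSet.mk (ζ.ζ V)) X = X := by
  obtain ⟨x, rfl⟩ := X.exists_mk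
  exact hp.liftsVAdd_eq (IsSum.zero hp ζ x)

theorem liftsVAdd_add {E : SmallExtension f V} {η : Fib p A} (τ₁ τ₂ : TangentSet p V)
    (X : Lifts E η) : (hp.liftsVAdd E η).vadd (hp.tangentAdd ζ τ₁ τ₂) X =
      (hp.liftsVAdd E η).vadd τ₁ ((hp.liftsVAdd E η).vadd τ₂ X) := by
  -- `IsSum.assoc` lists the summands in the order in which they act, whereas the action axiom lets
  -- `τ₂` act first; commutativity reconciles the two.
  rw [hp.tangentAdd_comm]
  obtain ⟨x₂, x₄, x₃, h'', rfl, rfl, e⟩ := hp.exists_tangent_sum ζ τ₂ τ₁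
  obtain ⟨x, rfl⟩ := X.exists_mk
  obtain ⟨y, h⟩ := IsSum.exists_sum hp x x₂.obj
  obtain ⟨z, h'⟩ := IsSum.exists_sum hp y x₃.obj
  rw [e, hp.liftsVAdd_eq h, hp.liftsVAdd_eq h', hp.liftsVAdd_eq (IsSum.assoc hp h h' h'')]

/-- `T_V` acts on `T_{η, A'}`. -/
@[reducible] noncomputable def liftsAddAction (E : SmallExtension f V) (η : Fib p A) :
    letI := hp.tangentAddCommGroup ζ V
    AddAction (TangentSet p V) (Lifts E η) :=
  letI := hp.tangentAddCommGroup ζ V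
  { hp.liftsVAdd E η with
    zero_vadd := hp.liftsVAdd_zero ζ
    add_vadd := hp.liftsVAdd_add ζ }

theorem isPseudotorsor_lifts (E : SmallExtension f V) (η : Fib p A) :
    letI := hp.tangentAddCommGroup ζ V
    letI := hp.liftsAddAction ζ E η
    IsPseudotorsor (TangentSet p V) (Lifts E η) := by
  let _ := hp.tangentAddCommGroup ζ V
  let _ := hp.liftsAddAction ζ E η
  refine (isEmpty_or_nonempty (Lifts E η)).imp id fun h => ⟨h, fun X Y => ?_⟩
  obtain ⟨x, rfl⟩ := X.exists_mk
  obtain ⟨y, rfl⟩ := Y.exists_mk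
  obtain ⟨η₂, hd⟩ := IsSum.exists_difference hp x y
  refine ⟨TangentSet.mk η₂, hp.liftsVAdd_eq hd, fun τ hτ => ?_⟩
  obtain ⟨θ, rfl⟩ := τ.exists_mk
  obtain ⟨y', h'⟩ := IsSum.exists_sum hp x θ
  have e : Lifts.mk y' = Lifts.mk y := (hp.liftsVAdd_eq h').symm.trans hτ
  obtain ⟨χ⟩ := IsSum.nonempty_hom_of_equiv hp h' hd (Setoid.refl x) (Lifts.mk_eq_mk.1 e)
  exact TangentSet.mk_eq_mk.2 ⟨hp.fibered.isoOfHom χ⟩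

/-- Agreement of the action with an arbitrary addition law: `L` itself supplies a witness for
`IsSum`, and `η` maps to the sum because `f ∘ p₁ = f ∘ σ`. -/
theorem vadd_mk_eq_add {ζ : TrivialObjects p} {E : SmallExtension f V} (L : AdditionLaw ζ E)
    {η : Fib p A} (x : LiftPair E η) (η₂ : Fib p (ArtAlg.kv k V Λ)) :
    ∃ χ : HomOver p f η (L.add x.obj η₂),
      x.map.1 ≫ (L.q₁ x.obj η₂).1 = χ.1 ≫ (L.push x.obj η₂).1 ∧
      (hp.liftsVAdd E η).vadd (TangentSet.mk η₂) (Lifts.mk x) =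
        (Lifts.mk ⟨L.add x.obj η₂, χ⟩ : Lifts E η) := by
  obtain ⟨χ, hχ⟩ := hp.fibered.exists_factor (L.push x.obj η₂) (x.map.comp (L.q₁ x.obj η₂) rfl)
    E.comp_σ.symm
  exact ⟨χ, hχ.symm, hp.liftsVAdd_eq (L.isSum x η₂ χ hχ.symm)⟩

theorem tangentAdd_mk (L : AdditionLaw ζ (triv Λ V)) (η₁ η₂ : Fib p (ArtAlg.kv k V Λ)) :
    hp.tangentAdd ζ (TangentSet.mk η₁) (TangentSet.mk η₂) = TangentSet.mk (L.add η₁ η₂) := by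
  obtain ⟨χ, hχ, -⟩ := hp.vadd_mk_eq_add L (hp.trivLift ζ η₁) η₂
  exact hp.tangentAdd_eq ζ (L.isSum _ _ χ hχ)

include hp in
theorem exists_tangent_map (h : V →ₗ[k] W) (τ : TangentSet p V) : ∃ τ' : TangentSet p W,
    ∀ (η : Fib p (ArtAlg.kv k V Λ)) (θ : Fib p (ArtAlg.kv k W Λ)), TangentSet.mk η = τ →
      HomOver p (ArtAlg.kvMap Λ h) θ η → τ' = TangentSet.mk θ := by
  obtain ⟨η, rfl⟩ := τ.exists_mk
  obtain ⟨θ, ⟨m⟩⟩ := hp.fibered.exists_pushforward (ArtAlg.kvMap Λ h) η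
  refine ⟨TangentSet.mk θ, fun η' θ' hη m' => ?_⟩
  obtain ⟨ψ⟩ := TangentSet.mk_eq_mk.1 hη.symm
  obtain ⟨u, -⟩ := hp.fibered.exists_fiber_factor m' (m.postcomp ψ.hom)
  exact TangentSet.mk_eq_mk.2 ⟨hp.fibered.isoOfHom u⟩

/-- The pushforward `T_V → T_W`. -/
noncomputable def tangentMapFun (h : V →ₗ[k] W) (τ : TangentSet p V) : TangentSet p W :=
  (hp.exists_tangent_map h τ).choose

theorem tangentMapFun_mk {h : V →ₗ[k] W} {η : Fib p (ArtAlg.kv k V Λ)}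
    {θ : Fib p (ArtAlg.kv k W Λ)} (m : HomOver p (ArtAlg.kvMap Λ h) θ η) :
    hp.tangentMapFun h (TangentSet.mk η) = TangentSet.mk θ :=
  (hp.exists_tangent_map h _).choose_spec η θ rfl m

theorem tangentMapFun_add (h : V →ₗ[k] W) (τ₁ τ₂ : TangentSet p V) :
    hp.tangentMapFun h (hp.tangentAdd ζ τ₁ τ₂) =
      hp.tangentAdd ζ (hp.tangentMapFun h τ₁) (hp.tangentMapFun h τ₂) := by
  obtain ⟨x, y, x₂, hs, rfl, rfl, e⟩ := hp.exists_tangent_sum ζ τ₁ τ₂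
  obtain ⟨θ, ⟨m⟩⟩ := hp.fibered.exists_pushforward (ArtAlg.kvMap Λ h) x.obj
  obtain ⟨θ', ⟨m'⟩⟩ := hp.fibered.exists_pushforward (ArtAlg.kvMap Λ h) y.obj
  obtain ⟨θ₂, ⟨m₂⟩⟩ := hp.fibered.exists_pushforward (ArtAlg.kvMap Λ h) x₂.obj
  rw [e, hp.tangentMapFun_mk m, hp.tangentMapFun_mk m', hp.tangentMapFun_mk m₂]
  have hι : ∀ v, ArtAlg.kvMap Λ h ((triv Λ V).ι v) = (triv Λ W).ι (h v) := fun _ => rfl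
  have hbase : ∀ {ξ : Fib p (ArtAlg.kv k V Λ)} {ξ' : Fib p (ArtAlg.kv k W Λ)}
      (t : HomOver p (ArtAlg.kvMap Λ h) ξ' ξ)
      (z : HomOver p (A := ArtAlg.base Λ k) (ArtAlg.kv k V Λ).π ζ.ζ₀ ξ)
      (z' : HomOver p (A := ArtAlg.base Λ k) (ArtAlg.kv k W Λ).π ζ.ζ₀ ξ'),
      z'.1 ≫ t.1 = (𝟙 ζ.ζ₀ : ζ.ζ₀ ⟶ ζ.ζ₀).1 ≫ z.1 := fun t z z' =>
    congrArg Subtype.val (hp.toBase_unique (z'.comp t rfl)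
      (z.precomp (𝟙 ζ.ζ₀)))
  -- Here `IsSum.map` is applied to `k[V] → k[W]` over the identity of `k`.
  exact (hp.tangentAdd_eq ζ (IsSum.map hp (x' := hp.trivLift ζ θ) (y' := hp.trivLift ζ θ')
    hι (HomOver.ofFiber (𝟙 ζ.ζ₀)) m m' (hbase _ _ _) (hbase _ _ _) m₂ hs)).symm

/-- The pushforward `T_V → T_W`, as a homomorphism of groups. -/
noncomputable def tangentMap (h : V →ₗ[k] W) :
    letI := hp.tangentAddCommGroup ζ V
    letI := hp.tangentAddCommGroup ζ W
    TangentSet p V →+ TangentSet p W :=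
  letI := hp.tangentAddCommGroup ζ V
  letI := hp.tangentAddCommGroup ζ W
  AddMonoidHom.mk' (hp.tangentMapFun h) (hp.tangentMapFun_add ζ h)

theorem tangentMapFun_id (τ : TangentSet p V) :
    hp.tangentMapFun (LinearMap.id : V →ₗ[k] V) τ = τ := by
  obtain ⟨η, rfl⟩ := τ.exists_mk
  exact hp.tangentMapFun_mk (HomOver.ofFiber (𝟙 η))

theorem tangentMapFun_comp (h : U →ₗ[k] V) (h' : V →ₗ[k] W) (τ : TangentSet p U) :
    hp.tangentMapFun (h' ∘ₗ h) τ = hp.tangentMapFun h' (hp.tangentMapFun h τ) := by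
  obtain ⟨η, rfl⟩ := τ.exists_mk
  obtain ⟨θ, ⟨m⟩⟩ := hp.fibered.exists_pushforward (ArtAlg.kvMap Λ h) η
  obtain ⟨ξ, ⟨m'⟩⟩ := hp.fibered.exists_pushforward (ArtAlg.kvMap Λ h') θ
  rw [hp.tangentMapFun_mk m, hp.tangentMapFun_mk m']
  exact hp.tangentMapFun_mk (m'.comp m rfl)

theorem exists_lifts_map {E : SmallExtension f V} {E₂ : SmallExtension f₂ W} {g : A' →ₐ[Λ] B'}
    {gbar : A →ₐ[Λ] B} {h : V →ₗ[k] W} (hg : ∀ x, gbar (f x) = f₂ (g x))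
    (hι : ∀ v, g (E.ι v) = E₂.ι (h v)) {η : Fib p A} {ηB : Fib p B} (t : HomOver p gbar ηB η) :
    ∃ R : Lifts E η → Lifts E₂ ηB,
      (∀ (x : LiftPair E η) (y : LiftPair E₂ ηB) (t' : HomOver p g y.obj x.obj),
        y.map.1 ≫ t'.1 = t.1 ≫ x.map.1 → R (Lifts.mk x) = Lifts.mk y) ∧
      ∀ (τ : TangentSet p V) (X : Lifts E η), R ((hp.liftsVAdd E η).vadd τ X) =
        (hp.liftsVAdd E₂ ηB).vadd (hp.tangentMapFun h τ) (R X) := by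
  have hS := hp.fibered
  have hg' : f₂.comp g = gbar.comp f := AlgHom.ext fun x => (hg x).symm
  have hex : ∀ x : LiftPair E η, ∃ (y : LiftPair E₂ ηB) (t' : HomOver p g y.obj x.obj),
      y.map.1 ≫ t'.1 = t.1 ≫ x.map.1 := by
    intro x
    obtain ⟨θ, ⟨t'⟩⟩ := hS.exists_pushforward g x.obj
    obtain ⟨r, hr⟩ := hS.exists_factor t' (t.comp x.map rfl) hg'
    exact ⟨⟨θ, r⟩, t', hr⟩
  have key : ∀ X : Lifts E η, ∃ Y : Lifts E₂ ηB, ∀ (x : LiftPair E η) (y : LiftPair E₂ ηB)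
      (t' : HomOver p g y.obj x.obj), Lifts.mk x = X → y.map.1 ≫ t'.1 = t.1 ≫ x.map.1 →
        Y = Lifts.mk y := by
    intro X
    obtain ⟨x, rfl⟩ := X.exists_mk
    obtain ⟨y, t', ht'⟩ := hex x
    refine ⟨Lifts.mk y, fun x₂ y₂ t₂ hx ht₂ => Lifts.mk_eq_mk.2 ?_⟩
    obtain ⟨ψ, hψ⟩ := Lifts.mk_eq_mk.1 hx.symm
    obtain ⟨u, hu⟩ := hS.exists_fiber_factor t₂ (t'.postcomp ψ.hom)
    replace hu : u.1 ≫ t₂.1 = t'.1 ≫ ψ.hom.1 := hu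
    refine ⟨hS.isoOfHom u, congrArg Subtype.val (hS.cancel t₂ (y.map.postcomp u) y₂.map ?_)⟩
    change (y.map.1 ≫ u.1) ≫ t₂.1 = y₂.map.1 ≫ t₂.1
    rw [Category.assoc, hu, reassoc_of% ht', hψ, ht₂]
  choose R hR using key
  refine ⟨R, fun x y t' ht' => hR _ x y t' rfl ht', fun τ X => ?_⟩
  obtain ⟨η₂, rfl⟩ := τ.exists_mk
  obtain ⟨x, rfl⟩ := X.exists_mk
  obtain ⟨y, hs⟩ := IsSum.exists_sum hp x η₂
  obtain ⟨x', tx, hx⟩ := hex x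
  obtain ⟨y', ty, hy⟩ := hex y
  obtain ⟨θ₂, ⟨m⟩⟩ := hS.exists_pushforward (ArtAlg.kvMap Λ h) η₂
  rw [hp.liftsVAdd_eq hs, hR _ x x' tx rfl hx, hR _ y y' ty rfl hy, hp.tangentMapFun_mk m,
    hp.liftsVAdd_eq (IsSum.map hp hι t tx ty hx hy m hs)]

end IsDeformationStack

end tangent

/-! ### The group `A_V` and its action on automorphisms -/

section automorphisms

variable {Λ k : Type u} [CommRing Λ] [Field k] [Algebra Λ k] [CompleteLocalBase Λ k]
  {S : Type u₂} [Category.{v₂} S] {p : S ⥤ (ArtAlg Λ k)ᵒᵖ}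
  {A' A B' B : ArtAlg Λ k} {f : A' →ₐ[Λ] A} {f₂ : B' →ₐ[Λ] B}
  {U : Type u} [AddCommGroup U] [Module k U] [FiniteDimensional k U]
  {V : Type u} [AddCommGroup V] [Module k V] [FiniteDimensional k V]
  {W : Type u} [AddCommGroup W] [Module k W] [FiniteDimensional k W]

open SmallExtension

theorem aut_mul_val {A : ArtAlg Λ k} {η : Fib p A} (φ ψ : Aut η) :
    (φ * ψ).hom.1 = ψ.hom.1 ≫ φ.hom.1 := rfl

theorem aut_one_val {A : ArtAlg Λ k} {η : Fib p A} : (1 : Aut η).hom.1 = 𝟙 η.1 := rfl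

theorem IsFiberedInGroupoids.exists_aut (hS : IsFiberedInGroupoids p) {f : A' →ₐ[Λ] A}
    {η' : Fib p A'} {η : Fib p A} (r : HomOver p f η η') (φ : Aut η') :
    ∃ ψ : Aut η, ψ.hom.1 ≫ r.1 = r.1 ≫ φ.hom.1 := by
  obtain ⟨t, ht⟩ := hS.exists_fiber_factor r (r.postcomp φ.hom)
  exact ⟨hS.isoOfHom t, ht⟩

theorem IsFiberedInGroupoids.aut_cancel (hS : IsFiberedInGroupoids p) {f : A' →ₐ[Λ] A}
    {η' : Fib p A'} {η : Fib p A} (r : HomOver p f η η') {φ ψ : Aut η}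
    (h : φ.hom.1 ≫ r.1 = ψ.hom.1 ≫ r.1) : φ = ψ :=
  Iso.ext (hS.fiber_cancel r _ _ h)

/-- The automorphism `φ'` of `η` is a sum of the automorphisms `φ` of `η` and `ψ` of `ζ_V`, up to
the identification of `η + ζ_V` with `η`. -/
def ZeroStar.IsAutSum {ζ : TrivialObjects p} {E : SmallExtension f V} {η : Fib p A'}
    (Z : ZeroStar ζ E η) (φ : Aut η) (ψ : AutGrp ζ V) (φ' : Aut η) : Prop :=
  ∃ h : Z.ω ⟶ Z.ω, Z.q₁.1 ≫ h.1 = φ.hom.1 ≫ Z.q₁.1 ∧ Z.q₂.1 ≫ h.1 = ψ.hom.1 ≫ Z.q₂.1 ∧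
    Z.s.1 ≫ h.1 = φ'.hom.1 ≫ Z.s.1

namespace ZeroStar

variable (hp : IsDeformationStack p) {ζ : TrivialObjects p} {E : SmallExtension f V}
  {η : Fib p A'} (Z : ZeroStar ζ E η)

include hp in
theorem comp_q₁_eq {η₀ : Fib p A} (r : HomOver p f η₀ η) : r.1 ≫ Z.q₁.1 = r.1 ≫ Z.s.1 :=
  hp.fibered.comp_eq_comp Z.c Z.q₁ Z.s r r E.comp_σ.symm (by rw [Z.q₁_c, Z.s_c])

include hp in
theorem exists_isAutSum (φ : Aut η) (ψ : AutGrp ζ V) : ∃ φ', Z.IsAutSum φ ψ φ' := by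
  obtain ⟨h, ⟨h₁, h₂⟩, -⟩ := hp.existsUnique_starHom (isFiberSquare_prodKV A' V) Z.q₁ Z.q₂
    Z.q₁ Z.q₂ φ.hom ψ.hom
  obtain ⟨φ', hφ'⟩ := hp.fibered.exists_aut Z.s (hp.fibered.isoOfHom h)
  exact ⟨φ', h, h₁, h₂, hφ'.symm⟩

variable {Z}

include hp in
theorem IsAutSum.unique {φ φ₁ φ₂ : Aut η} {ψ : AutGrp ζ V} (h : Z.IsAutSum φ ψ φ₁)
    (h' : Z.IsAutSum φ ψ φ₂) : φ₁ = φ₂ := by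
  obtain ⟨h, h₁, h₂, h₃⟩ := h
  obtain ⟨h', h₁', h₂', h₃'⟩ := h'
  have e := (hp.existsUnique_starHom (isFiberSquare_prodKV A' V) Z.q₁ Z.q₂ Z.q₁ Z.q₂ φ.hom
    ψ.hom).unique ⟨h₁, h₂⟩ ⟨h₁', h₂'⟩
  exact hp.fibered.aut_cancel Z.s (by rw [← h₃, ← h₃', e])

include hp in
-- Adding `ψ` does not change the restriction to `A`, because `q₁` and `s` become equal after
-- composition with any map over `f`.
theorem IsAutSum.restrict_eq {φ φ' : Aut η} {ψ : AutGrp ζ V} (h : Z.IsAutSum φ ψ φ')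
    {η₀ : Fib p A} (r : HomOver p f η₀ η) : r.1 ≫ φ'.hom.1 = r.1 ≫ φ.hom.1 := by
  obtain ⟨h, h₁, -, h₃⟩ := h
  have e := Z.comp_q₁_eq hp r
  have e₁ := Z.comp_q₁_eq hp (r.postcomp φ.hom)
  refine congrArg Subtype.val (hp.fibered.cancel Z.s (r.postcomp φ'.hom) (r.postcomp φ.hom) ?_)
  refine Eq.trans ?_ e₁
  change (r.1 ≫ φ'.hom.1) ≫ Z.s.1 = (r.1 ≫ φ.hom.1) ≫ Z.q₁.1
  rw [Category.assoc, Category.assoc, ← h₁, ← h₃, reassoc_of% e]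

variable (Z) in
include hp in
-- Surjectivity of `ψ ↦ id + ψ`: the identity and `φ'` agree over `A`, so they glue along the square
-- of `p₁` and `σ`, and the glued automorphism restricts along `p₂`.
theorem exists_isAutSum_one {η₀ : Fib p A} (r : HomOver p f η₀ η) {φ' : Aut η}
    (h : φ' ∈ autLiftsId r) : ∃ ψ, Z.IsAutSum 1 ψ φ' := by
  have e := Z.comp_q₁_eq hp r
  obtain ⟨j, ⟨h₁, h₂⟩, -⟩ := E.isFiberSquare_σ.existsUnique_hom hp Z.q₁ Z.s r r Z.q₁ Z.s r r e e
    (𝟙 η) φ'.hom (𝟙 η₀) ((Category.id_comp _).trans (Category.comp_id _).symm) h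
  obtain ⟨ψ, hψ⟩ := hp.fibered.exists_aut Z.q₂ (hp.fibered.isoOfHom j)
  exact ⟨ψ, j, h₁, hψ.symm, h₂⟩

include hp in
-- Injectivity of `ψ ↦ id + ψ`: an endomorphism of `ω` is also determined by its components along
-- `p₁` and `σ`.
theorem IsAutSum.unique_right {η₀ : Fib p A} (r : HomOver p f η₀ η) {φ' : Aut η}
    {ψ₁ ψ₂ : AutGrp ζ V} (h : Z.IsAutSum 1 ψ₁ φ') (h' : Z.IsAutSum 1 ψ₂ φ') : ψ₁ = ψ₂ := by
  have e := Z.comp_q₁_eq hp r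
  have hφ : (𝟙 η₀ : η₀ ⟶ η₀).1 ≫ r.1 = r.1 ≫ φ'.hom.1 :=
    (Category.id_comp _).trans ((Category.comp_id _).symm.trans (h.restrict_eq hp r).symm)
  obtain ⟨j, h₁, h₂, h₃⟩ := h
  obtain ⟨j', h₁', h₂', h₃'⟩ := h'
  have ej := (E.isFiberSquare_σ.existsUnique_hom hp Z.q₁ Z.s r r Z.q₁ Z.s r r e e
    (𝟙 η) φ'.hom (𝟙 η₀) ((Category.id_comp _).trans (Category.comp_id _).symm) hφ).unique
    ⟨h₁, h₃⟩ ⟨h₁', h₃'⟩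
  exact hp.fibered.aut_cancel Z.q₂ (by rw [← h₂, ← h₂', ej])

/-- The interchange law between sum and composition: the glued endomorphisms of `ω` compose. -/
theorem IsAutSum.mul {φ₁ φ₂ φ₁' φ₂' : Aut η} {ψ₁ ψ₂ : AutGrp ζ V} (h : Z.IsAutSum φ₁ ψ₁ φ₁')
    (h' : Z.IsAutSum φ₂ ψ₂ φ₂') : Z.IsAutSum (φ₁ * φ₂) (ψ₁ * ψ₂) (φ₁' * φ₂') := by
  obtain ⟨j, h₁, h₂, h₃⟩ := h
  obtain ⟨j', h₁', h₂', h₃'⟩ := h'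
  refine ⟨j' ≫ j, ?_, ?_, ?_⟩
  · rw [fib_comp_val, reassoc_of% h₁', h₁, aut_mul_val, Category.assoc]
  · rw [fib_comp_val, reassoc_of% h₂', h₂, aut_mul_val, Category.assoc]
  · rw [fib_comp_val, reassoc_of% h₃', h₃, aut_mul_val, Category.assoc]

variable (Z) in
include hp in
-- The witness is `φ` pushed forward under `incl`. Its component on `ζ_V` is trivial because `ζ_V`
-- maps to `η` through `ζ₀`, and maps from `ζ₀` absorb `φ`.
theorem isAutSum_zero (φ : Aut η) : Z.IsAutSum φ 1 φ := by
  obtain ⟨h, hh⟩ := hp.fibered.exists_aut Z.c φ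
  refine ⟨h.hom, ?_, ?_, ?_⟩
  · refine congrArg Subtype.val (hp.fibered.cancel Z.c (Z.q₁.postcomp h.hom)
      (Z.q₁.precomp φ.hom) ?_)
    change (Z.q₁.1 ≫ h.hom.1) ≫ Z.c.1 = (φ.hom.1 ≫ Z.q₁.1) ≫ Z.c.1
    rw [Category.assoc, Category.assoc, hh, reassoc_of% Z.q₁_c, Z.q₁_c, Category.comp_id]
  · have e : Z.z.1 ≫ φ.hom.1 = Z.z.1 :=
      congrArg Subtype.val (hp.toBase_unique (Z.z.postcomp φ.hom) Z.z)
    rw [aut_one_val, Category.id_comp]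
    refine congrArg Subtype.val (hp.fibered.cancel Z.c (Z.q₂.postcomp h.hom) Z.q₂ ?_)
    change (Z.q₂.1 ≫ h.hom.1) ≫ Z.c.1 = Z.q₂.1 ≫ Z.c.1
    rw [Category.assoc, hh, reassoc_of% Z.q₂_c, Z.q₂_c, e]
  · refine congrArg Subtype.val (hp.fibered.cancel Z.c (Z.s.postcomp h.hom)
      (Z.s.precomp φ.hom) ?_)
    change (Z.s.1 ≫ h.hom.1) ≫ Z.c.1 = (φ.hom.1 ≫ Z.s.1) ≫ Z.c.1
    rw [Category.assoc, Category.assoc, hh, reassoc_of% Z.s_c, Z.s_c, Category.comp_id]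

include hp in
-- Translates the relation into a statement about any addition law, through the comparison `j` of
-- `L.star η ζ_V` with `Z.ω`, both being pushforwards of `η` under `incl`.
theorem IsAutSum.addHom_unit {φ φ' : Aut η} {ψ : AutGrp ζ V} (h : Z.IsAutSum φ ψ φ')
    (L : AdditionLaw ζ E) : L.addHom φ.hom ψ.hom ≫ L.unit η = L.unit η ≫ φ'.hom := by
  have hS := hp.fibered
  obtain ⟨h, h₁, h₂, h₃⟩ := h
  obtain ⟨z, c, hc₁, hc₂, hu⟩ := L.unit_spec η
  obtain ⟨l, hl₁, hl₂, hl₃⟩ := L.map_spec φ.hom ψ.hom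
  change L.functor.map (X := (η, ζ.ζ V)) (Y := (η, ζ.ζ V)) (Prod.mkHom φ.hom ψ.hom) ≫ L.unit η =
    L.unit η ≫ φ'.hom
  generalize L.functor.map (X := (η, ζ.ζ V)) (Y := (η, ζ.ζ V)) (Prod.mkHom φ.hom ψ.hom) = a
    at hl₃ ⊢
  obtain ⟨j, hj⟩ := hS.exists_fiber_factor Z.c c
  have hj₁ : (L.q₁ η (ζ.ζ V)).1 ≫ j.1 = Z.q₁.1 := by
    refine congrArg Subtype.val (hS.cancel Z.c ((L.q₁ η (ζ.ζ V)).postcomp j) Z.q₁ ?_)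
    change ((L.q₁ η (ζ.ζ V)).1 ≫ j.1) ≫ Z.c.1 = Z.q₁.1 ≫ Z.c.1
    rw [Category.assoc, hj, hc₁, Z.q₁_c]
  have hj₂ : (L.q₂ η (ζ.ζ V)).1 ≫ j.1 = Z.q₂.1 := by
    refine congrArg Subtype.val (hS.cancel Z.c ((L.q₂ η (ζ.ζ V)).postcomp j) Z.q₂ ?_)
    change ((L.q₂ η (ζ.ζ V)).1 ≫ j.1) ≫ Z.c.1 = Z.q₂.1 ≫ Z.c.1
    rw [Category.assoc, hj, hc₂, Z.q₂_c, hp.toBase_unique z Z.z]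
  have hj₃ : (L.push η (ζ.ζ V)).1 ≫ j.1 = (L.unit η).1 ≫ Z.s.1 := by
    refine congrArg Subtype.val (hS.cancel Z.c ((L.push η (ζ.ζ V)).postcomp j)
      (Z.s.precomp (L.unit η)) ?_)
    change ((L.push η (ζ.ζ V)).1 ≫ j.1) ≫ Z.c.1 = ((L.unit η).1 ≫ Z.s.1) ≫ Z.c.1
    rw [Category.assoc, Category.assoc, hj, Z.s_c, Category.comp_id, hu]
  have e : l ≫ j = j ≫ h := by
    refine (hp.existsUnique_starHom (isFiberSquare_prodKV A' V) (L.q₁ η (ζ.ζ V))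
      (L.q₂ η (ζ.ζ V)) Z.q₁ Z.q₂ φ.hom ψ.hom).unique ⟨?_, ?_⟩ ⟨?_, ?_⟩
    · rw [fib_comp_val, reassoc_of% hl₁, hj₁]
    · rw [fib_comp_val, reassoc_of% hl₂, hj₂]
    · rw [fib_comp_val, reassoc_of% hj₁, h₁]
    · rw [fib_comp_val, reassoc_of% hj₂, h₂]
  replace e : l.1 ≫ j.1 = j.1 ≫ h.1 := congrArg Subtype.val e
  refine hS.fiber_cancel Z.s _ _ ?_
  change (a.1 ≫ (L.unit η).1) ≫ Z.s.1 = ((L.unit η).1 ≫ φ'.hom.1) ≫ Z.s.1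
  rw [Category.assoc, Category.assoc, ← hj₃, reassoc_of% hl₃, e, reassoc_of% hj₃, h₃]

end ZeroStar

namespace IsDeformationStack

variable (hp : IsDeformationStack p) (ζ : TrivialObjects p)

include hp in
-- Mirror image of `isAutSum_zero`: as `ζ_V` comes from `k`, the object `Z.ω` is also its
-- pushforward under the second inclusion `incl₂`, which `p₂` and `σ` retract.
theorem isAutSum_triv (Z : ZeroStar ζ (triv Λ V) (ζ.ζ V)) (ψ : AutGrp ζ V) :
    Z.IsAutSum 1 ψ ψ := by
  have hS := hp.fibered
  have hz : Z.z.1 ≫ (ζ.toζ₀ V).1 = 𝟙 ζ.ζ₀.1 := congrArg Subtype.val (hp.hom_base_unique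
    ((Z.z.comp (ζ.toζ₀ V) (e := AlgHom.id Λ (ArtAlg.base Λ k)) rfl).toFiber rfl) (𝟙 ζ.ζ₀))
  let incl₂ : ArtAlg.kv k V Λ →ₐ[Λ] prodKV (ArtAlg.kv k V Λ) V :=
    prodLift ((ArtAlg.kvIncl k V Λ).comp (ArtAlg.kv k V Λ).π) (AlgHom.id Λ _)
  have hσ : (triv Λ V).σ.comp incl₂ = AlgHom.id Λ _ := AlgHom.ext fun x =>
    ArtAlg.SqZero.ext (add_zero (ArtAlg.SqZero.re x)) (zero_add (ArtAlg.SqZero.im x))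
  -- The two inclusions of `k[V]` agree on `k`, which produces `c`. Its relations with `q₁`, `q₂`
  -- and `s` are tested after composition with the cartesian map `ζ_V → ζ₀`.
  obtain ⟨c, hc⟩ := hS.exists_factor (ζ.toζ₀ V) (Z.c.comp (ζ.toζ₀ V) rfl) (g := incl₂) rfl
  replace hc : c.1 ≫ (ζ.toζ₀ V).1 = Z.c.1 ≫ (ζ.toζ₀ V).1 := hc
  have hq₁ : Z.q₁.1 ≫ c.1 = (ζ.toζ₀ V).1 ≫ Z.z.1 := by
    refine congrArg Subtype.val (hS.cancel (ζ.toζ₀ V) (Z.q₁.comp c rfl)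
      ((ζ.toζ₀ V).comp Z.z rfl) ?_)
    change (Z.q₁.1 ≫ c.1) ≫ (ζ.toζ₀ V).1 = ((ζ.toζ₀ V).1 ≫ Z.z.1) ≫ (ζ.toζ₀ V).1
    rw [Category.assoc, Category.assoc, hc, hz, reassoc_of% Z.q₁_c, Category.comp_id]
  have hq₂ : Z.q₂.1 ≫ c.1 = 𝟙 (ζ.ζ V).1 := by
    refine congrArg Subtype.val (hS.cancel (ζ.toζ₀ V) (Z.q₂.comp c rfl)
      (HomOver.ofFiber (𝟙 (ζ.ζ V))) ?_)
    change (Z.q₂.1 ≫ c.1) ≫ (ζ.toζ₀ V).1 = 𝟙 (ζ.ζ V).1 ≫ (ζ.toζ₀ V).1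
    rw [Category.assoc, hc, reassoc_of% Z.q₂_c, hz, Category.comp_id, Category.id_comp]
  have hs : Z.s.1 ≫ c.1 = 𝟙 (ζ.ζ V).1 := by
    refine congrArg Subtype.val (hS.cancel (ζ.toζ₀ V) (Z.s.comp c hσ)
      (HomOver.ofFiber (𝟙 (ζ.ζ V))) ?_)
    change (Z.s.1 ≫ c.1) ≫ (ζ.toζ₀ V).1 = 𝟙 (ζ.ζ V).1 ≫ (ζ.toζ₀ V).1
    rw [Category.assoc, hc, reassoc_of% Z.s_c, Category.id_comp]
  obtain ⟨h, hh⟩ := hS.exists_aut c ψ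
  refine ⟨h.hom, ?_, ?_, ?_⟩
  · have e : Z.z.1 ≫ ψ.hom.1 = Z.z.1 :=
      congrArg Subtype.val (hp.toBase_unique (Z.z.postcomp ψ.hom) Z.z)
    rw [aut_one_val, Category.id_comp]
    refine congrArg Subtype.val (hS.cancel c (Z.q₁.postcomp h.hom) Z.q₁ ?_)
    change (Z.q₁.1 ≫ h.hom.1) ≫ c.1 = Z.q₁.1 ≫ c.1
    rw [Category.assoc, hh, reassoc_of% hq₁, hq₁, e]
  · refine congrArg Subtype.val (hS.cancel c (Z.q₂.postcomp h.hom) (Z.q₂.precomp ψ.hom) ?_)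
    change (Z.q₂.1 ≫ h.hom.1) ≫ c.1 = (ψ.hom.1 ≫ Z.q₂.1) ≫ c.1
    rw [Category.assoc, Category.assoc, hh, reassoc_of% hq₂, hq₂, Category.comp_id]
  · refine congrArg Subtype.val (hS.cancel c (Z.s.postcomp h.hom) (Z.s.precomp ψ.hom) ?_)
    change (Z.s.1 ≫ h.hom.1) ≫ c.1 = (ψ.hom.1 ≫ Z.s.1) ≫ c.1
    rw [Category.assoc, Category.assoc, hh, reassoc_of% hs, hs, Category.comp_id]

include hp in
-- Eckmann–Hilton: by interchange, both products of `φ + 1` and `1 + ψ` are sums of `φ` and `ψ`.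
theorem autGrp_mul_comm (φ ψ : AutGrp ζ V) : φ * ψ = ψ * φ := by
  obtain ⟨Z⟩ := hp.nonempty_zeroStar ζ (triv Λ V) (ζ.ζ V)
  have h := (Z.isAutSum_zero hp φ).mul (hp.isAutSum_triv ζ Z ψ)
  have h' := (hp.isAutSum_triv ζ Z ψ).mul (Z.isAutSum_zero hp φ)
  rw [mul_one, one_mul] at h h'
  exact h.unique hp h'

/-- The group structure of `A_V`, which is given by composition. -/
@[reducible] noncomputable def autAddCommGroup (V : Type u) [AddCommGroup V] [Module k V]
    [FiniteDimensional k V] : AddCommGroup (AutGrp ζ V) :=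
  letI : Add (AutGrp ζ V) := ⟨fun φ ψ => φ * ψ⟩
  letI : Zero (AutGrp ζ V) := ⟨(1 : Aut (ζ.ζ V))⟩
  letI : Neg (AutGrp ζ V) := ⟨fun φ => φ⁻¹⟩
  { AddGroup.ofLeftAxioms (G := AutGrp ζ V) (mul_assoc (G := Aut (ζ.ζ V)))
      (one_mul (M := Aut (ζ.ζ V))) (inv_mul_cancel (G := Aut (ζ.ζ V))) with
    add_comm := hp.autGrp_mul_comm ζ }

variable {ζ}

include hp in
theorem exists_autMap (h : V →ₗ[k] W) (φ : AutGrp ζ V) : ∃ φ' : AutGrp ζ W,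
    ∀ m : HomOver p (ArtAlg.kvMap Λ h) (ζ.ζ W) (ζ.ζ V), φ'.hom.1 ≫ m.1 = m.1 ≫ φ.hom.1 := by
  obtain ⟨m, -⟩ := hp.fibered.exists_factor (ζ.toζ₀ V) (ζ.toζ₀ W) (kvMap_comp_kvIncl h)
  obtain ⟨φ', hφ'⟩ := hp.fibered.exists_aut m φ
  refine ⟨φ', fun m' => ?_⟩
  -- Two maps `ζ_W → ζ_V` over the same ring map differ by an automorphism `a` of `ζ_W`. It commutes
  -- with `φ'`, so the pushforward does not depend on the map.
  obtain ⟨a, ha⟩ := hp.fibered.exists_fiber_factor m m'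
  have e : φ'.hom.1 ≫ a.1 = a.1 ≫ φ'.hom.1 := congrArg (fun x => x.hom.1)
    (hp.autGrp_mul_comm ζ (hp.fibered.isoOfHom a) φ')
  rw [← ha, reassoc_of% e, hφ', Category.assoc]

/-- The pushforward `A_V → A_W`. -/
noncomputable def autMapFun (h : V →ₗ[k] W) (φ : AutGrp ζ V) : AutGrp ζ W :=
  (hp.exists_autMap h φ).choose

theorem autMapFun_spec {h : V →ₗ[k] W} (m : HomOver p (ArtAlg.kvMap Λ h) (ζ.ζ W) (ζ.ζ V))
    (φ : AutGrp ζ V) : (hp.autMapFun h φ).hom.1 ≫ m.1 = m.1 ≫ φ.hom.1 :=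
  (hp.exists_autMap h φ).choose_spec m

theorem autMapFun_eq {h : V →ₗ[k] W} (m : HomOver p (ArtAlg.kvMap Λ h) (ζ.ζ W) (ζ.ζ V))
    {φ : AutGrp ζ V} {φ' : AutGrp ζ W} (e : φ'.hom.1 ≫ m.1 = m.1 ≫ φ.hom.1) :
    hp.autMapFun h φ = φ' :=
  hp.fibered.aut_cancel m ((hp.autMapFun_spec m φ).trans e.symm)

include hp in
variable (ζ) in
theorem exists_kvMap_hom (h : V →ₗ[k] W) : ∃ m : HomOver p (ArtAlg.kvMap Λ h) (ζ.ζ W) (ζ.ζ V),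
    m.1 ≫ (ζ.toζ₀ V).1 = (ζ.toζ₀ W).1 :=
  hp.fibered.exists_factor (ζ.toζ₀ V) (ζ.toζ₀ W) (kvMap_comp_kvIncl h)

theorem autMapFun_mul (h : V →ₗ[k] W) (φ ψ : AutGrp ζ V) :
    hp.autMapFun h (φ * ψ) = hp.autMapFun h φ * hp.autMapFun h ψ := by
  obtain ⟨m, -⟩ := hp.exists_kvMap_hom ζ h
  refine hp.autMapFun_eq m ?_
  rw [aut_mul_val, aut_mul_val, Category.assoc, hp.autMapFun_spec,
    reassoc_of% (hp.autMapFun_spec m ψ)]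

theorem autMapFun_id (φ : AutGrp ζ V) : hp.autMapFun (LinearMap.id : V →ₗ[k] V) φ = φ :=
  hp.autMapFun_eq (HomOver.ofFiber (𝟙 (ζ.ζ V))) ((Category.comp_id _).trans
    (Category.id_comp _).symm)

theorem autMapFun_comp (h : U →ₗ[k] V) (h' : V →ₗ[k] W) (φ : AutGrp ζ U) :
    hp.autMapFun (h' ∘ₗ h) φ = hp.autMapFun h' (hp.autMapFun h φ) := by
  obtain ⟨m, -⟩ := hp.exists_kvMap_hom ζ h
  obtain ⟨m', -⟩ := hp.exists_kvMap_hom ζ h'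
  refine hp.autMapFun_eq (m'.comp m rfl) ?_
  change _ ≫ m'.1 ≫ m.1 = (m'.1 ≫ m.1) ≫ _
  rw [reassoc_of% (hp.autMapFun_spec m' (hp.autMapFun h φ)), hp.autMapFun_spec m, Category.assoc]

variable (ζ) in
/-- The pushforward `A_V → A_W`, as a homomorphism of groups. -/
noncomputable def autMap (h : V →ₗ[k] W) :
    letI := hp.autAddCommGroup ζ V
    letI := hp.autAddCommGroup ζ W
    AutGrp ζ V →+ AutGrp ζ W :=
  letI := hp.autAddCommGroup ζ V
  letI := hp.autAddCommGroup ζ W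
  AddMonoidHom.mk' (hp.autMapFun h) (hp.autMapFun_mul h)

theorem isAutSum_map {E : SmallExtension f V} {E₂ : SmallExtension f₂ W} {g : A' →ₐ[Λ] B'}
    {h : V →ₗ[k] W} (hι : ∀ v, g (E.ι v) = E₂.ι (h v)) {η : Fib p A'} {θ : Fib p B'}
    {Z : ZeroStar ζ E η} (Z₂ : ZeroStar ζ E₂ θ) (t : HomOver p g θ η) {φ φ' : Aut η}
    {φ₂ φ₂' : Aut θ} {ψ : AutGrp ζ V} (hφ : φ₂.hom.1 ≫ t.1 = t.1 ≫ φ.hom.1)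
    (hφ' : φ₂'.hom.1 ≫ t.1 = t.1 ≫ φ'.hom.1) (hs : Z.IsAutSum φ ψ φ') :
    Z₂.IsAutSum φ₂ (hp.autMapFun h ψ) φ₂' := by
  have hS := hp.fibered
  obtain ⟨j, h₁, h₂, h₃⟩ := hs
  obtain ⟨m, hm⟩ := hp.exists_kvMap_hom ζ h
  -- `T` is the map induced on the objects `ω`. Through it `j` restricts to `j'`, whose three
  -- components are read off after composing with `T`.
  obtain ⟨T, hT⟩ := hS.exists_factor Z.c (Z₂.c.comp t rfl) (prodMap_comp_incl g h)
  replace hT : T.1 ≫ Z.c.1 = Z₂.c.1 ≫ t.1 := hT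
  have hσ := σ_comp_prodMap E E₂ hι
  have hz : Z₂.z.1 ≫ t.1 = Z.z.1 :=
    congrArg Subtype.val (hp.toBase_unique (Z₂.z.comp t (π_comp_hom g)) Z.z)
  have hq₁ : Z₂.q₁.1 ≫ T.1 = t.1 ≫ Z.q₁.1 := by
    refine hS.comp_eq_comp Z.c T Z.q₁ Z₂.q₁ t rfl ?_
    rw [hT, Z.q₁_c, Category.comp_id, reassoc_of% Z₂.q₁_c]
  have hs : Z₂.s.1 ≫ T.1 = t.1 ≫ Z.s.1 := by
    refine hS.comp_eq_comp Z.c T Z.s Z₂.s t hσ.symm ?_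
    rw [hT, Z.s_c, Category.comp_id, reassoc_of% Z₂.s_c]
  have hq₂ : Z₂.q₂.1 ≫ T.1 = m.1 ≫ Z.q₂.1 := by
    refine hS.comp_eq_comp Z.c T Z.q₂ Z₂.q₂ m rfl ?_
    rw [hT, Z.q₂_c, reassoc_of% Z₂.q₂_c, hz, reassoc_of% hm]
  obtain ⟨j', hj'⟩ := hS.exists_aut T (hS.isoOfHom j)
  replace hj' : j'.hom.1 ≫ T.1 = T.1 ≫ j.1 := hj'
  have hψ := hp.autMapFun_spec m ψ
  refine ⟨j'.hom, ?_, ?_, ?_⟩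
  · refine congrArg Subtype.val (hS.cancel T (Z₂.q₁.postcomp j'.hom)
      (Z₂.q₁.precomp φ₂.hom) ?_)
    change (Z₂.q₁.1 ≫ j'.hom.1) ≫ T.1 = (φ₂.hom.1 ≫ Z₂.q₁.1) ≫ T.1
    rw [Category.assoc, Category.assoc, hj', hq₁, reassoc_of% hq₁, h₁, reassoc_of% hφ]
  · refine congrArg Subtype.val (hS.cancel T (Z₂.q₂.postcomp j'.hom)
      (Z₂.q₂.precomp (hp.autMapFun h ψ).hom) ?_)
    change (Z₂.q₂.1 ≫ j'.hom.1) ≫ T.1 = ((hp.autMapFun h ψ).hom.1 ≫ Z₂.q₂.1) ≫ T.1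
    rw [Category.assoc, Category.assoc, hj', hq₂, reassoc_of% hq₂, h₂, reassoc_of% hψ]
  · refine congrArg Subtype.val (hS.cancel T (Z₂.s.postcomp j'.hom)
      (Z₂.s.precomp φ₂'.hom) ?_)
    change (Z₂.s.1 ≫ j'.hom.1) ≫ T.1 = (φ₂'.hom.1 ≫ Z₂.s.1) ≫ T.1
    rw [Category.assoc, Category.assoc, hj', hs, reassoc_of% hs, h₃, reassoc_of% hφ']

variable (ζ) in
/-- A choice of the data of `ZeroStar`. -/
noncomputable def zeroStar (E : SmallExtension f V) (η : Fib p A') : ZeroStar ζ E η :=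
  (hp.nonempty_zeroStar ζ E η).some

/-- The map `ψ ↦ id + ψ` from `A_V` to the automorphisms of `η'`. -/
noncomputable def autIsoFun (E : SmallExtension f V) (η' : Fib p A') (ψ : AutGrp ζ V) : Aut η' :=
  ((hp.zeroStar ζ E η').exists_isAutSum hp 1 ψ).choose

theorem autIsoFun_spec (E : SmallExtension f V) (η' : Fib p A') (ψ : AutGrp ζ V) :
    (hp.zeroStar ζ E η').IsAutSum 1 ψ (hp.autIsoFun E η' ψ) :=
  ((hp.zeroStar ζ E η').exists_isAutSum hp 1 ψ).choose_spec

theorem autIsoFun_mem (E : SmallExtension f V) {η₀ : Fib p A} {η' : Fib p A'}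
    (r : HomOver p f η₀ η') (ψ : AutGrp ζ V) : hp.autIsoFun E η' ψ ∈ autLiftsId r :=
  (Category.id_comp _).trans ((Category.comp_id _).symm.trans
    ((hp.autIsoFun_spec E η' ψ).restrict_eq hp r).symm)

theorem autIsoFun_mul (E : SmallExtension f V) (η' : Fib p A') (ψ₁ ψ₂ : AutGrp ζ V) :
    hp.autIsoFun E η' (ψ₁ * ψ₂) = hp.autIsoFun E η' ψ₁ * hp.autIsoFun E η' ψ₂ := by
  have h := (hp.autIsoFun_spec E η' ψ₁).mul (hp.autIsoFun_spec E η' ψ₂)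
  rw [mul_one] at h
  exact (hp.autIsoFun_spec E η' (ψ₁ * ψ₂)).unique hp h

variable (ζ) in
/-- The isomorphism of `A_V` with `A_{id, η'}`. -/
noncomputable def autIso (E : SmallExtension f V) {η₀ : Fib p A} {η' : Fib p A'}
    (r : HomOver p f η₀ η') : AutGrp ζ V ≃* autLiftsId r :=
  MulEquiv.ofBijective
    (MonoidHom.mk' (fun ψ => ⟨hp.autIsoFun E η' ψ, hp.autIsoFun_mem E r ψ⟩)
      fun ψ₁ ψ₂ => Subtype.ext (hp.autIsoFun_mul E η' ψ₁ ψ₂))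
    ⟨fun ψ₁ ψ₂ e => by
      have e' : hp.autIsoFun E η' ψ₁ = hp.autIsoFun E η' ψ₂ := congrArg Subtype.val e
      have h := hp.autIsoFun_spec E η' ψ₁
      rw [e'] at h
      exact h.unique_right hp r (hp.autIsoFun_spec E η' ψ₂), fun φ => by
      obtain ⟨ψ, hψ⟩ := (hp.zeroStar ζ E η').exists_isAutSum_one hp r φ.2
      exact ⟨ψ, Subtype.ext ((hp.autIsoFun_spec E η' ψ).unique hp hψ)⟩⟩

/-- Interchange applied to `1 + ψ` and `φ + 1`. This is why adding `ψ` is the same as composing with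
`id + ψ`. -/
theorem isAutSum_autIsoFun_mul (E : SmallExtension f V) {η' : Fib p A'} (φ : Aut η')
    (ψ : AutGrp ζ V) : (hp.zeroStar ζ E η').IsAutSum φ ψ (hp.autIsoFun E η' ψ * φ) := by
  have h := (hp.autIsoFun_spec E η' ψ).mul ((hp.zeroStar ζ E η').isAutSum_zero hp φ)
  rwa [one_mul, mul_one] at h

theorem autIsoFun_map {E : SmallExtension f V} {E₂ : SmallExtension f₂ W} {g : A' →ₐ[Λ] B'}
    {h : V →ₗ[k] W} (hι : ∀ v, g (E.ι v) = E₂.ι (h v)) {η : Fib p A'} {θ : Fib p B'}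
    (t : HomOver p g θ η) (ψ : AutGrp ζ V) :
    (hp.autIsoFun E₂ θ (hp.autMapFun h ψ)).hom.1 ≫ t.1 = t.1 ≫ (hp.autIsoFun E η ψ).hom.1 := by
  obtain ⟨α, hα⟩ := hp.fibered.exists_aut t (hp.autIsoFun E η ψ)
  have hs := hp.isAutSum_map hι (hp.zeroStar ζ E₂ θ) t (φ := 1) (φ₂ := 1)
    ((Category.id_comp _).trans (Category.comp_id _).symm) hα (hp.autIsoFun_spec E η ψ)
  rw [(hp.autIsoFun_spec E₂ θ _).unique hp hs, hα]

variable (ζ) in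
/-- The action of `A_V` on `A_{φ, η'}`. -/
@[reducible] noncomputable def autAddAction (E : SmallExtension f V) {η₀ : Fib p A}
    {η' : Fib p A'} (r : HomOver p f η₀ η') (φ : Aut η₀) :
    letI := hp.autAddCommGroup ζ V
    AddAction (AutGrp ζ V) (AutLifts E r φ) :=
  letI := hp.autAddCommGroup ζ V
  { vadd := fun ψ φ' => ⟨hp.autIsoFun E η' ψ * φ'.1, by
      have h : (𝟙 η₀ : η₀ ⟶ η₀).1 ≫ r.1 = r.1 ≫ (hp.autIsoFun E η' ψ).hom.1 :=
        hp.autIsoFun_mem E r ψ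
      rw [aut_mul_val, ← reassoc_of% φ'.2, ← h, fib_id_val, Category.id_comp]⟩
    zero_vadd := fun φ' => Subtype.ext (by
      have h : hp.autIsoFun E η' (1 : AutGrp ζ V) = 1 :=
        congrArg Subtype.val (map_one (hp.autIso ζ E r))
      exact (congrArg (· * φ'.1) h).trans (one_mul _))
    add_vadd := fun ψ₁ ψ₂ φ' => Subtype.ext
      ((congrArg (· * φ'.1) (hp.autIsoFun_mul E η' ψ₁ ψ₂)).trans (mul_assoc _ _ _)) }

theorem isPseudotorsor_autLifts (E : SmallExtension f V) {η₀ : Fib p A}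
    {η' : Fib p A'} (r : HomOver p f η₀ η') (φ : Aut η₀) :
    letI := hp.autAddCommGroup ζ V
    letI := hp.autAddAction ζ E r φ
    IsPseudotorsor (AutGrp ζ V) (AutLifts E r φ) := by
  let _ := hp.autAddCommGroup ζ V
  let _ := hp.autAddAction ζ E r φ
  refine (isEmpty_or_nonempty (AutLifts E r φ)).imp id fun h => ⟨h, ?_⟩
  rintro ⟨φ₁, hφ₁⟩ ⟨φ₂, hφ₂⟩
  -- Two lifts of `φ` differ by a lift of the identity, so simple transitivity reduces to the
  -- bijectivity of `autIso`.
  have hmem : φ₂ * φ₁⁻¹ ∈ autLiftsId r := by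
    change (𝟙 η₀ : η₀ ⟶ η₀).1 ≫ r.1 = r.1 ≫ φ₁.inv.1 ≫ φ₂.hom.1
    have h₁ : φ₁.hom.1 ≫ φ₁.inv.1 = 𝟙 η'.1 := congrArg Subtype.val φ₁.hom_inv_id
    have h₂ : φ.inv.1 ≫ φ.hom.1 = 𝟙 η₀.1 := congrArg Subtype.val φ.inv_hom_id
    have e : r.1 ≫ φ₁.inv.1 = φ.inv.1 ≫ r.1 := by
      calc r.1 ≫ φ₁.inv.1 = φ.inv.1 ≫ (φ.hom.1 ≫ r.1) ≫ φ₁.inv.1 := by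
            rw [Category.assoc, reassoc_of% h₂]
        _ = φ.inv.1 ≫ r.1 := by rw [hφ₁, Category.assoc, h₁, Category.comp_id]
    rw [reassoc_of% e, ← hφ₂, reassoc_of% h₂, fib_id_val, Category.id_comp]
  obtain ⟨ψ, hψ⟩ := (hp.autIso ζ E r).surjective ⟨_, hmem⟩
  have hψ' : hp.autIsoFun E η' ψ = φ₂ * φ₁⁻¹ := congrArg Subtype.val hψ
  refine ⟨ψ, Subtype.ext ?_, fun ψ' hψ' => (hp.autIso ζ E r).injective ?_⟩
  · exact (congrArg (· * φ₁) hψ').trans (inv_mul_cancel_right _ _)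
  · rw [hψ]
    have : hp.autIsoFun E η' ψ' * φ₁ = φ₂ := congrArg Subtype.val hψ'
    exact Subtype.ext (eq_mul_inv_of_mul_eq this)

theorem exists_autLifts_map {E : SmallExtension f V} {E₂ : SmallExtension f₂ W}
    {g : A' →ₐ[Λ] B'} {gbar : A →ₐ[Λ] B} {h : V →ₗ[k] W} (hι : ∀ v, g (E.ι v) = E₂.ι (h v))
    {η₀ : Fib p A} {η' : Fib p A'} {θ₀ : Fib p B} {θ' : Fib p B'}
    (r : HomOver p f η₀ η') (s : HomOver p f₂ θ₀ θ') (t : HomOver p gbar θ₀ η₀)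
    (t' : HomOver p g θ' η') (ht : t.1 ≫ r.1 = s.1 ≫ t'.1) (φ : Aut η₀) (φB : Aut θ₀)
    (hφ : φB.hom.1 ≫ t.1 = t.1 ≫ φ.hom.1) :
    ∃ R : AutLifts E r φ → AutLifts E₂ s φB,
      (∀ φ' : AutLifts E r φ, (R φ').1.hom.1 ≫ t'.1 = t'.1 ≫ φ'.1.hom.1) ∧
      ∀ (ψ : AutGrp ζ V) (φ' : AutLifts E r φ), R ((hp.autAddAction ζ E r φ).vadd ψ φ') =
        (hp.autAddAction ζ E₂ s φB).vadd (hp.autMapFun h ψ) (R φ') := by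
  have hS := hp.fibered
  have key : ∀ φ' : AutLifts E r φ, ∃ φ₂ : AutLifts E₂ s φB,
      φ₂.1.hom.1 ≫ t'.1 = t'.1 ≫ φ'.1.hom.1 := by
    rintro ⟨φ', hφ'⟩
    obtain ⟨φ₂, hφ₂⟩ := hS.exists_aut t' φ'
    refine ⟨⟨φ₂, congrArg Subtype.val
      (hS.cancel t' (s.precomp φB.hom) (s.postcomp φ₂.hom) ?_)⟩, hφ₂⟩
    change (φB.hom.1 ≫ s.1) ≫ t'.1 = (s.1 ≫ φ₂.hom.1) ≫ t'.1
    rw [Category.assoc, Category.assoc, hφ₂, ← ht, reassoc_of% hφ, hφ', reassoc_of% ht]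
  choose R hR using key
  refine ⟨R, hR, fun ψ φ' => Subtype.ext (hS.aut_cancel t' ?_)⟩
  rw [hR]
  change t'.1 ≫ φ'.1.hom.1 ≫ (hp.autIsoFun E η' ψ).hom.1 =
    ((R φ').1.hom.1 ≫ (hp.autIsoFun E₂ θ' (hp.autMapFun h ψ)).hom.1) ≫ t'.1
  rw [Category.assoc, hp.autIsoFun_map hι t', reassoc_of% (hR φ')]

end IsDeformationStack

end automorphisms

/-! ### The main theorem -/

/-- The structures asserted to exist are determined by the clauses that follow: their values on
representatives are prescribed by any addition law, and such laws exist by the first conjunct. This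
is the sense in which they are canonical. -/
theorem theorem2 {Λ k : Type u} [CommRing Λ] [Field k] [Algebra Λ k] [CompleteLocalBase Λ k]
    {S : Type u₂} [Category.{v₂} S] (p : S ⥤ (ArtAlg Λ k)ᵒᵖ) (hp : IsDeformationStack p)
    (ζ : TrivialObjects p) :
    -- the addition law `+_{A', V}` exists for every small extension `A' → A` with kernel `V`
    (∀ {A' A : ArtAlg Λ k} {f : A' →ₐ[Λ] A} {V : Type u} [AddCommGroup V] [Module k V]
      [FiniteDimensional k V] (E : SmallExtension f V), Nonempty (AdditionLaw ζ E)) ∧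
    -- group structures on `T_V` and `A_V`
    ∃ (_ : ∀ (V : Type u) [AddCommGroup V] [Module k V] [FiniteDimensional k V],
        AddCommGroup (TangentSet p V))
      (_ : ∀ (V : Type u) [AddCommGroup V] [Module k V] [FiniteDimensional k V],
        AddCommGroup (AutGrp ζ V))
      -- pushforwards along linear maps, which are additive
      (mapT : ∀ {V W : Type u} [AddCommGroup V] [Module k V] [FiniteDimensional k V]
        [AddCommGroup W] [Module k W] [FiniteDimensional k W],
        (V →ₗ[k] W) → (TangentSet p V →+ TangentSet p W))
      (mapA : ∀ {V W : Type u} [AddCommGroup V] [Module k V] [FiniteDimensional k V]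
        [AddCommGroup W] [Module k W] [FiniteDimensional k W],
        (V →ₗ[k] W) → (AutGrp ζ V →+ AutGrp ζ W))
      -- the action of `T_V` on `T_{η, A'}`
      (_ : ∀ {A' A : ArtAlg Λ k} {f : A' →ₐ[Λ] A} {V : Type u} [AddCommGroup V] [Module k V]
        [FiniteDimensional k V] (E : SmallExtension f V) (η : Fib p A),
        AddAction (TangentSet p V) (Lifts E η))
      -- the isomorphism of `A_V` with `A_{id, η'}`
      (isoA : ∀ {A' A : ArtAlg Λ k} {f : A' →ₐ[Λ] A} {V : Type u} [AddCommGroup V] [Module k V]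
        [FiniteDimensional k V] (_ : SmallExtension f V) {η₀ : Fib p A} {η' : Fib p A'}
        (r : HomOver p f η₀ η'), AutGrp ζ V ≃* autLiftsId r)
      -- the action of `A_V` on `A_{φ, η'}`
      (_ : ∀ {A' A : ArtAlg Λ k} {f : A' →ₐ[Λ] A} {V : Type u} [AddCommGroup V] [Module k V]
        [FiniteDimensional k V] (E : SmallExtension f V) {η₀ : Fib p A} {η' : Fib p A'}
        (r : HomOver p f η₀ η') (φ : Aut η₀), AddAction (AutGrp ζ V) (AutLifts E r φ)),
    -- (1) the group structures are given by `+_{k[V], V}`, for any realization of the latter, and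
    -- addition on `A_V` is composition
    (∀ (V : Type u) [AddCommGroup V] [Module k V] [FiniteDimensional k V]
      (L : AdditionLaw ζ (SmallExtension.triv Λ V)),
      (∀ η₁ η₂ : Fib p (ArtAlg.kv k V Λ),
        TangentSet.mk η₁ + TangentSet.mk η₂ = TangentSet.mk (L.add η₁ η₂)) ∧
      (∀ φ₁ φ₂ : AutGrp ζ V,
        L.addHom φ₁.hom φ₂.hom ≫ L.unit (ζ.ζ V) = L.unit (ζ.ζ V) ≫ (φ₁ + φ₂).hom)) ∧
    (∀ (V : Type u) [AddCommGroup V] [Module k V] [FiniteDimensional k V] (φ₁ φ₂ : AutGrp ζ V),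
      φ₁ + φ₂ = φ₁ * φ₂) ∧
    -- `mapT` and `mapA` are the pushforwards, for any choice of the latter
    (∀ {V W : Type u} [AddCommGroup V] [Module k V] [FiniteDimensional k V]
      [AddCommGroup W] [Module k W] [FiniteDimensional k W] (h : V →ₗ[k] W),
      (∀ (η : Fib p (ArtAlg.kv k V Λ)) (θ : Fib p (ArtAlg.kv k W Λ)),
        HomOver p (ArtAlg.kvMap Λ h) θ η → mapT h (TangentSet.mk η) = TangentSet.mk θ) ∧
      (∀ (m : HomOver p (ArtAlg.kvMap Λ h) (ζ.ζ W) (ζ.ζ V)) (φ : AutGrp ζ V),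
        (mapA h φ).hom.1 ≫ m.1 = m.1 ≫ φ.hom.1)) ∧
    -- and they are functorial in `V`
    (∀ (V : Type u) [AddCommGroup V] [Module k V] [FiniteDimensional k V],
      mapT (LinearMap.id : V →ₗ[k] V) = AddMonoidHom.id _ ∧
      mapA (LinearMap.id : V →ₗ[k] V) = AddMonoidHom.id _) ∧
    (∀ {U V W : Type u} [AddCommGroup U] [Module k U] [FiniteDimensional k U]
      [AddCommGroup V] [Module k V] [FiniteDimensional k V]
      [AddCommGroup W] [Module k W] [FiniteDimensional k W] (h : U →ₗ[k] V) (h' : V →ₗ[k] W),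
      mapT (h' ∘ₗ h) = (mapT h').comp (mapT h) ∧ mapA (h' ∘ₗ h) = (mapA h').comp (mapA h)) ∧
    -- (2) `+_{A', V}` induces the action of `T_V` on `T_{η, A'}`, which is a pseudotorsor
    (∀ {A' A : ArtAlg Λ k} {f : A' →ₐ[Λ] A} {V : Type u} [AddCommGroup V] [Module k V]
      [FiniteDimensional k V] (E : SmallExtension f V) (η : Fib p A),
      (∀ (L : AdditionLaw ζ E) (x : LiftPair E η) (η₂ : Fib p (ArtAlg.kv k V Λ)),
        ∃ χ : HomOver p f η (L.add x.obj η₂),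
          x.map.1 ≫ (L.q₁ x.obj η₂).1 = χ.1 ≫ (L.push x.obj η₂).1 ∧
          TangentSet.mk η₂ +ᵥ Lifts.mk x = (Lifts.mk ⟨L.add x.obj η₂, χ⟩ : Lifts E η)) ∧
      IsPseudotorsor (TangentSet p V) (Lifts E η)) ∧
    -- (3) `+_{A', V}` induces the isomorphism of `A_V` with `A_{id, η'}` and the action of `A_V`
    -- on `A_{φ, η'}`, which is a pseudotorsor
    (∀ {A' A : ArtAlg Λ k} {f : A' →ₐ[Λ] A} {V : Type u} [AddCommGroup V] [Module k V]
      [FiniteDimensional k V] (E : SmallExtension f V) {η₀ : Fib p A} {η' : Fib p A'}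
      (r : HomOver p f η₀ η'),
      (∀ (L : AdditionLaw ζ E) (ψ : AutGrp ζ V),
        L.addHom (𝟙 η') ψ.hom ≫ L.unit η' = L.unit η' ≫ (isoA E r ψ).1.hom) ∧
      ∀ φ : Aut η₀,
        (∀ (ψ : AutGrp ζ V) (φ' : AutLifts E r φ),
          (ψ +ᵥ φ').1 = (isoA E r ψ).1 * φ'.1 ∧
          ∀ L : AdditionLaw ζ E,
            L.addHom φ'.1.hom ψ.hom ≫ L.unit η' = L.unit η' ≫ (ψ +ᵥ φ').1.hom) ∧
        IsPseudotorsor (AutGrp ζ V) (AutLifts E r φ)) ∧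
    -- (4) functoriality of both pseudotorsor structures: `g : A' → B'` induces `gbar : A → B` and
    -- `h : V → W` on the kernels
    (∀ {A' A B' B : ArtAlg Λ k} {f : A' →ₐ[Λ] A} {f₂ : B' →ₐ[Λ] B}
      {V W : Type u} [AddCommGroup V] [Module k V] [FiniteDimensional k V]
      [AddCommGroup W] [Module k W] [FiniteDimensional k W]
      (E : SmallExtension f V) (E₂ : SmallExtension f₂ W)
      (g : A' →ₐ[Λ] B') (gbar : A →ₐ[Λ] B) (h : V →ₗ[k] W),
      (∀ x, gbar (f x) = f₂ (g x)) → (∀ v, g (E.ι v) = E₂.ι (h v)) →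
      (∀ (η : Fib p A) (ηB : Fib p B) (t : HomOver p gbar ηB η),
        ∃ R : Lifts E η → Lifts E₂ ηB,
          (∀ (x : LiftPair E η) (y : LiftPair E₂ ηB) (t' : HomOver p g y.obj x.obj),
            y.map.1 ≫ t'.1 = t.1 ≫ x.map.1 → R (Lifts.mk x) = Lifts.mk y) ∧
          ∀ (τ : TangentSet p V) (x : Lifts E η), R (τ +ᵥ x) = mapT h τ +ᵥ R x) ∧
      (∀ {η₀ : Fib p A} {η' : Fib p A'} {θ₀ : Fib p B} {θ' : Fib p B'}
        (r : HomOver p f η₀ η') (s : HomOver p f₂ θ₀ θ')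
        (t : HomOver p gbar θ₀ η₀) (t' : HomOver p g θ' η'),
        t.1 ≫ r.1 = s.1 ≫ t'.1 →
        ∀ (φ : Aut η₀) (φB : Aut θ₀), φB.hom.1 ≫ t.1 = t.1 ≫ φ.hom.1 →
        ∃ R : AutLifts E r φ → AutLifts E₂ s φB,
          (∀ φ' : AutLifts E r φ, (R φ').1.hom.1 ≫ t'.1 = t'.1 ≫ φ'.1.hom.1) ∧
          ∀ (ψ : AutGrp ζ V) (φ' : AutLifts E r φ), R (ψ +ᵥ φ') = mapA h ψ +ᵥ R φ')) := by
  refine ⟨hp.nonempty_additionLaw ζ, fun V => hp.tangentAddCommGroup ζ V,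
    fun V => hp.autAddCommGroup ζ V, hp.tangentMap ζ, hp.autMap ζ, hp.liftsAddAction ζ,
    hp.autIso ζ, hp.autAddAction ζ, ?_, ?_, ?_, ?_, ?_, ?_, ?_, ?_⟩
  · intro V _ _ _ L
    refine ⟨hp.tangentAdd_mk ζ L, fun φ₁ φ₂ => ?_⟩
    let Z := hp.zeroStar ζ (SmallExtension.triv Λ V) (ζ.ζ V)
    -- Eckmann–Hilton again: `(φ₁ + 1) * (1 + φ₂)` is the sum of `φ₁` and `φ₂`, so the sum is the
    -- composite.
    have h := (Z.isAutSum_zero hp φ₁).mul (hp.isAutSum_triv ζ Z φ₂)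
    rw [mul_one, one_mul] at h
    exact h.addHom_unit hp L
  · intro V _ _ _ φ₁ φ₂
    rfl
  · intro V W _ _ _ _ _ _ h
    exact ⟨fun _ _ m => hp.tangentMapFun_mk m, hp.autMapFun_spec⟩
  · intro V _ _ _
    exact ⟨DFunLike.ext _ _ hp.tangentMapFun_id, DFunLike.ext _ _ hp.autMapFun_id⟩
  · intro U V W _ _ _ _ _ _ _ _ _ h h'
    exact ⟨DFunLike.ext _ _ (hp.tangentMapFun_comp h h'), DFunLike.ext _ _ (hp.autMapFun_comp h h')⟩
  · intro A' A f V _ _ _ E η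
    exact ⟨fun L x η₂ => hp.vadd_mk_eq_add L x η₂, hp.isPseudotorsor_lifts ζ E η⟩
  · intro A' A f V _ _ _ E η₀ η' r
    exact ⟨fun L ψ => (hp.autIsoFun_spec E η' ψ).addHom_unit hp L,
      fun φ => ⟨fun ψ φ' => ⟨rfl, fun L =>
        (hp.isAutSum_autIsoFun_mul E φ'.1 ψ).addHom_unit hp L⟩,
        hp.isPseudotorsor_autLifts E r φ⟩⟩
  · intro A' A B' B f f₂ V W _ _ _ _ _ _ E E₂ g gbar h hg hι
    exact ⟨fun η ηB t => hp.exists_lifts_map hg hι t,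
      fun r s t t' ht φ φB hφ => hp.exists_autLifts_map hι r s t t' ht φ φB hφ⟩
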